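/- Work over $\mathbb{C}$ and let $m,n\in\mathbb{N}$ (zero allowed). A \emph{line} in $\mathbb{P}^{n+1}\times\mathbb{P}^{m+1}$ is an irreducible closed curve $\ell\subset\mathbb{P}^{n+1}\times\mathbb{P}^{m+1}$ whose degree with respect to $\mathcal{O}(1,1)$ is $1$. The \emph{Fano variety of lines} $F(\mathbb{P}^{n+1}\times\mathbb{P}^{m+1})$ is the set of these lines, with the (reduced) variety structure induced from the Grassmannian of lines of $\mathbb{P}^{N}$, $N=(n+2)(m+2)-1$, through the Segre embedding $\mathbb{P}^{n+1}\times\mathbb{P}^{m+1}\hookrightarrow\mathbb{P}^{N}$. Let $Gr(1,r)$ be the Grassmannian of lines of $\mathbb{P}^{r}$. Then: (1) A subset $\ell\subset\mathbb{P}^{n+1}\times\mathbb{P}^{m+1}$ is a line if and only if $\ell=L\times\{y\}$ for a line $L\subset\mathbb{P}^{n+1}$ and a point $y\in\mathbb{P}^{m+1}$, or $\ell=\{x\}\times M$ for a point $x\in\mathbb{P}^{n+1}$ and a line $M\subset\mathbb{P}^{m+1}$. (2) Sending a line $\ell$ to the linear span of its Segre image is a bijection from the lines in $\mathbb{P}^{n+1}\times\mathbb{P}^{m+1}$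 onto the projective lines of $\mathbb{P}^{N}$ contained in the Segre variety (so that the structure on $F$ above makes sense). (3) The map given by $(L,y)\mapsto L\times\{y\}$ on the first piece and by $(x,M)\mapsto\{x\}\times M$ on the second one is an isomorphism of varieties $$\big(Gr(1,n+1)\times\mathbb{P}^{m+1}\big)\sqcup\big(\mathbb{P}^{n+1}\times Gr(1,m+1)\big)\;\xrightarrow{\ \sim\ }\;F(\mathbb{P}^{n+1}\times\mathbb{P}^{m+1}).$$ -/

import Mathlib

open MvPolynomial Filter Topology

noncomputable section

/-- A set of points over `ℂ` given with (multi)homogeneous coordinates: the coordinate variables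
carry weights in a monoid `Deg` of (multi)degrees, and `coord x` is a choice of homogeneous
coordinates of the point `x`. (Whether a multihomogeneous polynomial vanishes at `x`, and the value
at `x` of a quotient of two such polynomials of equal degree, do not depend on that choice.) -/
structure CoordSpace where
  Pt : Type
  Var : Type
  Deg : Type
  [instDeg : AddCommMonoid Deg]
  wt : Var → Deg
  coord : Pt → Var → ℂ

attribute [instance] CoordSpace.instDeg

/-- A space with functions: a topological space together with the notion of a regular function
on each open set (only the values of `f` on `U` matter in `regular U f`). -/
structure FunSpace where
  Pt : Type
  top : TopologicalSpace Pt
  regular : Set Pt → (Pt → ℂ) → Prop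

/-- Disjoint union of two spaces with functions. -/
def FunSpace.disjUnion (X Y : FunSpace) : FunSpace where
  Pt := X.Pt ⊕ Y.Pt
  top := @instTopologicalSpaceSum X.Pt Y.Pt X.top Y.top
  regular U f := X.regular (Sum.inl ⁻¹' U) (f ∘ Sum.inl) ∧ Y.regular (Sum.inr ⁻¹' U) (f ∘ Sum.inr)

/-- Isomorphism of spaces with functions: a homeomorphism under which the regular functions
on corresponding open sets correspond. -/
structure FunSpace.Iso (X Y : FunSpace) where
  toEquiv : X.Pt ≃ Y.Pt
  isOpen_iff : ∀ U : Set Y.Pt, IsOpen[X.top] (toEquiv ⁻¹' U) ↔ IsOpen[Y.top] U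
  regular_iff : ∀ U : Set Y.Pt, IsOpen[Y.top] U → ∀ f : Y.Pt → ℂ,
    (X.regular (toEquiv ⁻¹' U) (f ∘ toEquiv) ↔ Y.regular U f)

namespace CoordSpace

/-- The Zariski topology; a basis is given by the non-vanishing loci of (multi)homogeneous
polynomials. -/
@[reducible]
def zariski (X : CoordSpace) : TopologicalSpace X.Pt :=
  TopologicalSpace.generateFrom
    {U | ∃ (d : X.Deg) (F : MvPolynomial X.Var ℂ), IsWeightedHomogeneous X.wt F d ∧
      U = {x | eval (X.coord x) F ≠ 0}}

/-- Regular functions on an open set: locally quotients of two (multi)homogeneous polynomials of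
the same (multi)degree. -/
def IsRegular (X : CoordSpace) (U : Set X.Pt) (f : X.Pt → ℂ) : Prop :=
  ∀ x ∈ U, ∃ V : Set X.Pt, IsOpen[X.zariski] V ∧ x ∈ V ∧ V ⊆ U ∧
    ∃ (d : X.Deg) (G H : MvPolynomial X.Var ℂ),
      IsWeightedHomogeneous X.wt G d ∧ IsWeightedHomogeneous X.wt H d ∧
      ∀ z ∈ V, eval (X.coord z) H ≠ 0 ∧ f z = eval (X.coord z) G / eval (X.coord z) H

/-- The variety structure (as a space with functions) given by homogeneous coordinates. -/
def toFunSpace (X : CoordSpace) : FunSpace where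
  Pt := X.Pt
  top := X.zariski
  regular := X.IsRegular

/-- The product of two varieties, with multihomogeneous coordinates: those of the first factor
followed by those of the second one, homogeneous in each set of variables separately. -/
def prod (X Y : CoordSpace) : CoordSpace where
  Pt := X.Pt × Y.Pt
  Var := X.Var ⊕ Y.Var
  Deg := X.Deg × Y.Deg
  wt := Sum.elim (fun i => (X.wt i, 0)) (fun j => (0, Y.wt j))
  coord p := Sum.elim (X.coord p.1) (Y.coord p.2)

/-- An irreducible curve: an irreducible Zariski closed subset of dimension one. -/
def IsIrreducibleCurve (X : CoordSpace) (C : Set X.Pt) : Prop :=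
  IsClosed[X.zariski] C ∧ @IsIrreducible _ X.zariski C ∧
    @topologicalKrullDim C (TopologicalSpace.induced Subtype.val X.zariski) = 1

/-- Evaluation of polynomials at the points of `C`. Its kernel on the forms of a fixed degree
consists of the forms of this degree that vanish on `C`. -/
def evalOn (X : CoordSpace) (C : Set X.Pt) : MvPolynomial X.Var ℂ →ₗ[ℂ] (C → ℂ) where
  toFun F x := eval (X.coord x.1) F
  map_add' F G := by ext x; simp
  map_smul' a F := by ext x; simp [MvPolynomial.smul_eval]

/-- The Hilbert function of `C`: the dimension of the degree-`d` part of the homogeneous coordinate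
ring of `C`, that is, of the space of forms of degree `d` modulo those that vanish on `C`. -/
def hilbertFunction (X : CoordSpace) (C : Set X.Pt) (d : X.Deg) : ℕ :=
  Module.finrank ℂ ((weightedHomogeneousSubmodule ℂ X.wt d).map (X.evalOn C))

/-- The curve `C` has degree `e` with respect to the line bundle `𝒪(d)`: its Hilbert polynomial
`t ↦ χ(C, 𝒪(t d))` is `e t + c` for some constant `c`. -/
def HasDegree (X : CoordSpace) (d : X.Deg) (C : Set X.Pt) (e : ℕ) : Prop :=
  ∃ c : ℤ, ∀ᶠ t : ℕ in atTop, (X.hilbertFunction C (t • d) : ℤ) = e * t + c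

end CoordSpace

/-- Projective space `ℙ^r` over `ℂ`. -/
def projSpace (r : ℕ) : CoordSpace where
  Pt := Projectivization ℂ (Fin (r + 1) → ℂ)
  Var := Fin (r + 1)
  Deg := ℕ
  wt _ := 1
  coord x := x.rep

/-- Plücker coordinates `v i * w j - v j * w i` of a two-dimensional subspace of `ℂ^κ` with
basis `v`, `w` (and the junk value `0` if the subspace does not have dimension two). -/
def pluckerVec {κ : Type} [Finite κ] (W : Submodule ℂ (κ → ℂ)) : κ × κ → ℂ :=
  open Classical in
  if h : Module.finrank ℂ W = 2 then
    fun p =>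
      let b := Module.finBasisOfFinrankEq ℂ W h
      (b 0 : κ → ℂ) p.1 * (b 1 : κ → ℂ) p.2 - (b 0 : κ → ℂ) p.2 * (b 1 : κ → ℂ) p.1
  else 0

/-- The Grassmannian `Gr(1, r)` of lines in `ℙ^r`: two-dimensional subspaces of `ℂ^(r+1)`, with
Plücker coordinates. -/
def grLines (r : ℕ) : CoordSpace where
  Pt := {W : Submodule ℂ (Fin (r + 1) → ℂ) // Module.finrank ℂ W = 2}
  Var := Fin (r + 1) × Fin (r + 1)
  Deg := ℕ
  wt _ := 1
  coord W := pluckerVec W.1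

/-- The set of points of `ℙ^r` on the line `L`. -/
def linePoints {r : ℕ} (L : (grLines r).Pt) : Set (projSpace r).Pt :=
  {x : Projectivization ℂ (Fin (r + 1) → ℂ) | x.submodule ≤ L.1}

/-- The product `ℙ^r × ℙ^s`. -/
def biProj (r s : ℕ) : CoordSpace := (projSpace r).prod (projSpace s)

/-- The subset `A × B` of `ℙ^r × ℙ^s`. -/
def biProjRect {r s : ℕ} (A : Set (projSpace r).Pt) (B : Set (projSpace s).Pt) :
    Set (biProj r s).Pt :=
  A ×ˢ B

/-- A line in `ℙ^r × ℙ^s`: an irreducible curve of degree one with respect to `𝒪(1,1)`. -/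
def IsLineInBiProj (r s : ℕ) (C : Set (biProj r s).Pt) : Prop :=
  (biProj r s).IsIrreducibleCurve C ∧
    (biProj r s).HasDegree (((1 : ℕ), (1 : ℕ)) : ℕ × ℕ) C 1

/-- The Segre map on vectors, `(v, w) ↦ (v i * w j)`. -/
def segreVec {r s : ℕ} (v : Fin (r + 1) → ℂ) (w : Fin (s + 1) → ℂ) :
    Fin (r + 1) × Fin (s + 1) → ℂ :=
  fun p => v p.1 * w p.2

/-- The linear span, in the vector space `ℂ^((r+1)(s+1))`, of the image of `C` under the Segre
embedding of `ℙ^r × ℙ^s` by `𝒪(1,1)`. -/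
def segreSpan {r s : ℕ} (C : Set (biProj r s).Pt) :
    Submodule ℂ (Fin (r + 1) × Fin (s + 1) → ℂ) :=
  Submodule.span ℂ
    {u | ∃ p ∈ C, u = segreVec ((projSpace r).coord p.1) ((projSpace s).coord p.2)}

/-- The Fano variety of lines of `ℙ^r × ℙ^s`: its points are the lines in `ℙ^r × ℙ^s`, and its
variety structure is the one induced from the Grassmannian of lines of `ℙ^N`,
`N = (r+1)(s+1) - 1`, through the Segre embedding. -/
def fanoLines (r s : ℕ) : CoordSpace where
  Pt := {C : Set (biProj r s).Pt // IsLineInBiProj r s C}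
  Var := (Fin (r + 1) × Fin (s + 1)) × (Fin (r + 1) × Fin (s + 1))
  Deg := ℕ
  wt _ := 1
  coord C := pluckerVec (segreSpan C.1)

/-- The disjoint union `(Gr(1,r) × ℙ^s) ⊔ (ℙ^r × Gr(1,s))`. -/
def grUnion (r s : ℕ) : FunSpace :=
  ((grLines r).prod (projSpace s)).toFunSpace.disjUnion
    ((projSpace r).prod (grLines s)).toFunSpace

end

/-!
A line `W` of `ℙ^N` that lies on the Segre variety is a two-dimensional space of pure tensors. If
`a ⊗ c`, `a' ⊗ c'` and their sum are pure, the minors of the sum, which are products of a minor of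
`(a, a')` and a minor of `(c, c')`, vanish, and so the tensors share a factor
(`exists_smul_of_segreVec_add_eq`). Hence `W = L ⊗ y` or `W = x ⊗ M`
(`IsSegreLine.exists_eq_map`), and the points of `ℙ^r × ℙ^s` over `W` form `L × {y}` or `{x} × M`.

These sets are lines in the sense of the Hilbert polynomial. Along the parametrisation
`t ↦ (a + t a') ⊗ c` (or the one with the factors exchanged) a form becomes a polynomial in `t`. It
follows that forms have finitely many zeros, so that the Zariski topology is the cofinite one, which
is irreducible of dimension one, and that the forms of bidegree `(t, t)` restrict to the polynomials
of degree at most `t`, a space of dimension `t + 1` (`IsSegreLine.isLineInBiProj`).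

Conversely, let `C` be an irreducible curve whose Hilbert polynomial is `t + k`, and let `f` be a
form of bidegree `(1, 1)` that does not vanish on `C`. Since the coordinate ring of `C` is a domain,
multiplication by `f` is injective on it, and its cokernel in large degrees is one-dimensional. If
`f` vanished at two points of `C`, the forms separating these points would give a cokernel of
dimension two (`eq_zero_of_apply_segrePt_eq_zero`). So the linear span of the Segre image of `C` is
spanned by any two of its points. Being infinite, `C` has a third point; this forces the span to lie
on the Segre variety, and `C`, closed and infinite, is everything over the span
(`IsLineInBiProj.segrePreimage_segreSpan`).

For the isomorphism, the Plücker coordinates of `L × {y}` are the products `p i k * y j * y l`, and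
those of `{x} × M` are `x i * x k * q j l`, where `p` and `q` are the Plücker coordinates of `L` and
`M`. So both maps to the Fano variety are given by forms. Their images are the open loci where some
coordinate with indices `(i, j), (k, j)`, respectively `(i, j), (i, l)`, does not vanish, and there
the inverse is given by linear forms in the Plücker coordinates (`exists_local_inverse_inl`,
`exists_local_inverse_inr`). Maps given by forms pull back open sets and regular functions, which
gives the isomorphism (`CoordSpace.exists_iso_of_isPolyOn`).
-/

noncomputable section

attribute [local instance] CoordSpace.zariski

/-! ### Forms, polynomial maps and regular functions -/

namespace CoordSpace

/-- Rescaling the variables by a character of the degree monoid multiplies a form by the value of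
the character at its degree. -/
theorem eval_of_scaled {σ M : Type*} [AddCommMonoid M] {w : σ → M} {F : MvPolynomial σ ℂ} {d : M}
    (hF : IsWeightedHomogeneous w F d) (χ : Multiplicative M →* ℂˣ) {g h : σ → ℂ}
    (hg : ∀ v, g v = χ (.ofAdd (w v)) * h v) :
    eval g F = χ (.ofAdd d) * eval h F := by
  induction hF using IsWeightedHomogeneous.induction_on with
  | zero => simp
  | add p q _ _ hp hq => rw [map_add, map_add, hp, hq, mul_add]
  | monomial e r he =>
    subst he
    simp only [eval_monomial, Finsupp.weight_apply, Finsupp.prod, Finsupp.sum, hg, mul_pow,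
      Finset.prod_mul_distrib, ofAdd_sum, map_prod, ofAdd_nsmul, map_pow, Units.coe_prod,
      Units.val_pow_eq_pow_val]
    ring

theorem isWeightedHomogeneous_bind₁ {σ τ M N : Type*} [AddCommMonoid M] [AddCommMonoid N]
    {w : σ → M} {w' : τ → N} {F : MvPolynomial σ ℂ} {d : M} (hF : IsWeightedHomogeneous w F d)
    (δ : M →+ N) {Q : σ → MvPolynomial τ ℂ}
    (hQ : ∀ v, IsWeightedHomogeneous w' (Q v) (δ (w v))) :
    IsWeightedHomogeneous w' (bind₁ Q F) (δ d) := by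
  induction hF using IsWeightedHomogeneous.induction_on with
  | zero => simpa using isWeightedHomogeneous_zero ℂ w' _
  | add p q _ _ hp hq => simpa using hp.add hq
  | monomial e r he =>
    subst he
    rw [bind₁_monomial, Finsupp.weight_apply, Finsupp.sum, map_sum]
    simp only [map_nsmul]
    exact (IsWeightedHomogeneous.prod _ _ _ fun v _ => (hQ v).pow _).C_mul r

open Polynomial in
theorem natDegree_aeval_le {σ M : Type*} [AddCommMonoid M]
    {w : σ → M} {F : MvPolynomial σ ℂ} {d : M} (hF : IsWeightedHomogeneous w F d)
    (δ : M →+ ℕ) {P : σ → ℂ[X]} (hP : ∀ v, (P v).natDegree ≤ δ (w v)) :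
    (aeval P F).natDegree ≤ δ d := by
  induction hF using IsWeightedHomogeneous.induction_on with
  | zero => simp
  | add p q _ _ hp hq => 
    rw [map_add]
    exact (natDegree_add_le _ _).trans (max_le hp hq)
  | monomial e r he =>
    subst he
    rw [MvPolynomial.aeval_monomial, Finsupp.weight_apply, Finsupp.sum, map_sum, Finsupp.prod]
    refine (natDegree_C_mul_le _ _).trans ((natDegree_prod_le _ _).trans
      (Finset.sum_le_sum fun v _ => natDegree_pow_le.trans ?_))
    rw [map_nsmul, smul_eq_mul]
    exact Nat.mul_le_mul_left _ (hP v)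

theorem isOpen_ne_zero (X : CoordSpace) {d : X.Deg} {F : MvPolynomial X.Var ℂ}
    (hF : IsWeightedHomogeneous X.wt F d) : IsOpen {x : X.Pt | eval (X.coord x) F ≠ 0} :=
  TopologicalSpace.isOpen_generateFrom_of_mem ⟨d, F, hF, rfl⟩

/-- On `V`, the map `φ` is given in coordinates by forms `Q`, up to a rescaling of the coordinates
of the target. The form `Q v` has degree `δ (wt v)`, so that forms pull back to forms. -/
def IsPolyOn {X Z : CoordSpace} (φ : X.Pt → Z.Pt) (V : Set X.Pt) : Prop :=
  ∃ (δ : Z.Deg →+ X.Deg) (Q : Z.Var → MvPolynomial X.Var ℂ),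
    (∀ v, IsWeightedHomogeneous X.wt (Q v) (δ (Z.wt v))) ∧
    ∀ x ∈ V, ∃ χ : Multiplicative Z.Deg →* ℂˣ, ∀ v,
      Z.coord (φ x) v = χ (.ofAdd (Z.wt v)) * eval (X.coord x) (Q v)

namespace IsPolyOn
variable {X Z : CoordSpace} {φ : X.Pt → Z.Pt} {V : Set X.Pt}

/-- The pullback of forms: the first two properties are compatible with the grading, the last one
says that values are preserved up to a factor depending on the point and the degree only. -/
theorem exists_pullback (h : IsPolyOn φ V) : ∃ (δ : Z.Deg → X.Deg)
    (Ψ : MvPolynomial Z.Var ℂ → MvPolynomial X.Var ℂ),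
    (∀ d F, IsWeightedHomogeneous Z.wt F d → IsWeightedHomogeneous X.wt (Ψ F) (δ d)) ∧
    ∀ x ∈ V, ∀ d, ∃ c : ℂ, c ≠ 0 ∧ ∀ F, IsWeightedHomogeneous Z.wt F d →
      eval (Z.coord (φ x)) F = c * eval (X.coord x) (Ψ F) := by
  obtain ⟨δ, Q, hQ, hχ⟩ := h
  refine ⟨δ, bind₁ Q, fun d F hF => isWeightedHomogeneous_bind₁ hF δ hQ, fun x hx d => ?_⟩
  obtain ⟨χ, h⟩ := hχ x hx
  refine ⟨χ (.ofAdd d), (χ (.ofAdd d)).ne_zero, fun F hF => ?_⟩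
  rw [eval_of_scaled hF χ h]
  simp [← MvPolynomial.aeval_eq_eval, aeval_bind₁]

theorem isOpen_inter_preimage (h : IsPolyOn φ V) (hV : IsOpen V) {U : Set Z.Pt} (hU : IsOpen U) :
    IsOpen (V ∩ φ ⁻¹' U) := by
  obtain ⟨δ, Ψ, hΨ, hc⟩ := h.exists_pullback
  induction hU with
  | basic s hs =>
    obtain ⟨d, F, hF, rfl⟩ := hs
    convert hV.inter (X.isOpen_ne_zero (hΨ d F hF)) using 1
    ext x
    refine and_congr_right fun hx => ?_
    obtain ⟨c, hc0, hcF⟩ := hc x hx d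
    simp [hcF F hF, hc0]
  | univ => simpa using hV
  | inter s t _ _ hs ht =>
    rw [Set.preimage_inter, Set.inter_inter_distrib_left]
    exact hs.inter ht
  | sUnion S _ hS =>
    rw [Set.preimage_sUnion, Set.inter_iUnion₂]
    exact isOpen_biUnion hS

/-- Pulling back a function that is regular on `U`, near a point that is mapped into `U`. -/
theorem isRegular_comp (h : IsPolyOn φ V) (hV : IsOpen V) {U : Set Z.Pt} {f : Z.Pt → ℂ}
    (hf : Z.IsRegular U f) : X.IsRegular (V ∩ φ ⁻¹' U) (f ∘ φ) := by
  rintro x ⟨hxV, hxU⟩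
  obtain ⟨δ, Ψ, hΨ, hc⟩ := h.exists_pullback
  obtain ⟨W, hW, hxW, hWU, d, G, H, hG, hH, hGH⟩ := hf _ hxU
  refine ⟨V ∩ φ ⁻¹' W, h.isOpen_inter_preimage hV hW, ⟨hxV, hxW⟩,
    Set.inter_subset_inter_right _ (Set.preimage_mono hWU), δ d, Ψ G, Ψ H, hΨ _ _ hG, hΨ _ _ hH,
    fun z ⟨hzV, hzW⟩ => ?_⟩
  obtain ⟨c, hc0, hcF⟩ := hc z hzV d
  have := hGH _ hzW
  rw [hcF G hG, hcF H hH, mul_div_mul_left _ _ hc0] at this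
  exact ⟨(mul_ne_zero_iff.mp this.1).2, this.2⟩

end IsPolyOn

/-- Regularity is a local property. -/
theorem IsRegular.of_local {X : CoordSpace} {U : Set X.Pt} {f : X.Pt → ℂ}
    (h : ∀ x ∈ U, ∃ (V : Set X.Pt) (g : X.Pt → ℂ), x ∈ V ∧ V ⊆ U ∧ X.IsRegular V g ∧
      Set.EqOn f g V) : X.IsRegular U f := by
  intro x hx
  obtain ⟨V, g, hxV, hVU, hg, hfg⟩ := h x hx
  obtain ⟨W, hW, hxW, hWV, d, G, H, hG, hH, hGH⟩ := hg x hxV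
  exact ⟨W, hW, hxW, hWV.trans hVU, d, G, H, hG, hH, fun z hz =>
    ⟨(hGH z hz).1, (hfg (hWV hz)).trans (hGH z hz).2⟩⟩

/-- A bijection from a disjoint union onto `Z` is an isomorphism of spaces with functions if both
of its components are given by forms, and if near every point of `Z` one of the components has an
inverse given by forms. -/
theorem exists_iso_of_isPolyOn {X Y Z : CoordSpace} (e : X.Pt ⊕ Y.Pt ≃ Z.Pt)
    (hX : IsPolyOn (X := X) (Z := Z) (fun x => e (.inl x)) Set.univ)
    (hY : IsPolyOn (X := Y) (Z := Z) (fun y => e (.inr y)) Set.univ)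
    (hX' : ∀ x, ∃ (V : Set Z.Pt) (ψ : Z.Pt → X.Pt), IsOpen V ∧ e (.inl x) ∈ V ∧ IsPolyOn ψ V ∧
      ∀ z ∈ V, e (.inl (ψ z)) = z)
    (hY' : ∀ y, ∃ (V : Set Z.Pt) (ψ : Z.Pt → Y.Pt), IsOpen V ∧ e (.inr y) ∈ V ∧ IsPolyOn ψ V ∧
      ∀ z ∈ V, e (.inr (ψ z)) = z) :
    ∃ Φ : (X.toFunSpace.disjUnion Y.toFunSpace).Iso Z.toFunSpace, ∀ p, Φ.toEquiv p = e p := by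
  have key : ∀ {T : CoordSpace} {i : T.Pt → Z.Pt} {V : Set Z.Pt} {ψ : Z.Pt → T.Pt} {z : Z.Pt}
      {U : Set Z.Pt}, IsOpen V → z ∈ V → z ∈ U → IsPolyOn ψ V → (∀ z ∈ V, i (ψ z) = z) →
      IsOpen (i ⁻¹' U) → z ∈ V ∩ ψ ⁻¹' (i ⁻¹' U) ∧ V ∩ ψ ⁻¹' (i ⁻¹' U) ⊆ U ∧
      IsOpen (V ∩ ψ ⁻¹' (i ⁻¹' U)) := by
    intro T i V ψ z U hV hzV hzU hψ hi hU
    refine ⟨⟨hzV, ?_⟩, fun w hw => ?_, hψ.isOpen_inter_preimage hV hU⟩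
    · simpa [hi z hzV] using hzU
    · simpa [hi w hw.1] using hw.2
  have hopen : ∀ U : Set Z.Pt, (IsOpen ((fun x => e (.inl x)) ⁻¹' U) ∧
      IsOpen ((fun y => e (.inr y)) ⁻¹' U)) ↔ IsOpen U := by
    intro U
    refine ⟨fun ⟨h1, h2⟩ => isOpen_iff_forall_mem_open.mpr fun z hz => ?_, fun hU => ?_⟩
    · obtain ⟨x | y, rfl⟩ := e.surjective z
      · obtain ⟨V, ψ, hV, hzV, hψ, hi⟩ := hX' x
        have := key hV hzV hz hψ hi h1
        exact ⟨_, this.2.1, this.2.2, this.1⟩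
      · obtain ⟨V, ψ, hV, hzV, hψ, hi⟩ := hY' y
        have := key hV hzV hz hψ hi h2
        exact ⟨_, this.2.1, this.2.2, this.1⟩
    · have h1 := hX.isOpen_inter_preimage isOpen_univ hU
      have h2 := hY.isOpen_inter_preimage isOpen_univ hU
      rw [Set.univ_inter] at h1 h2
      exact ⟨h1, h2⟩
  refine ⟨⟨e, fun U => ?_, fun U hU f => ?_⟩, fun p => rfl⟩
  · exact Iff.trans (@isOpen_sum_iff _ _ X.zariski Y.zariski _) (hopen U)
  · change (X.IsRegular ((fun x => e (.inl x)) ⁻¹' U) (f ∘ fun x => e (.inl x)) ∧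
      Y.IsRegular ((fun y => e (.inr y)) ⁻¹' U) (f ∘ fun y => e (.inr y))) ↔ Z.IsRegular U f
    obtain ⟨hU1, hU2⟩ := (hopen U).mpr hU
    refine ⟨fun ⟨h1, h2⟩ => IsRegular.of_local fun z hz => ?_, fun hf => ?_⟩
    · obtain ⟨x | y, rfl⟩ := e.surjective z
      · obtain ⟨V, ψ, hV, hzV, hψ, hi⟩ := hX' x
        have := key hV hzV hz hψ hi hU1
        exact ⟨_, _, this.1, this.2.1, hψ.isRegular_comp hV h1, fun w hw =>
          congrArg f (hi w hw.1).symm⟩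
      · obtain ⟨V, ψ, hV, hzV, hψ, hi⟩ := hY' y
        have := key hV hzV hz hψ hi hU2
        exact ⟨_, _, this.1, this.2.1, hψ.isRegular_comp hV h2, fun w hw =>
          congrArg f (hi w hw.1).symm⟩
    · have h1 := hX.isRegular_comp isOpen_univ hf
      have h2 := hY.isRegular_comp isOpen_univ hf
      rw [Set.univ_inter] at h1 h2
      exact ⟨h1, h2⟩

/-- If every form that does not vanish identically on `C` has only finitely many zeros on `C`,
then every open set meeting `C` contains all but finitely many points of `C`. -/
theorem finite_diff_of_isOpen {X : CoordSpace} {C : Set X.Pt}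
    (hC : ∀ d F, IsWeightedHomogeneous X.wt F d → ∀ z ∈ C, eval (X.coord z) F ≠ 0 →
      {w ∈ C | eval (X.coord w) F = 0}.Finite)
    {U : Set X.Pt} (hU : IsOpen U) (hCU : (C ∩ U).Nonempty) : (C \ U).Finite := by
  induction hU with
  | basic s hs =>
    obtain ⟨d, F, hF, rfl⟩ := hs
    obtain ⟨z, hz, hzF⟩ := hCU
    convert hC d F hF z hz hzF using 1
    ext w
    simp
  | univ => simp
  | inter s t _ _ hs ht =>
    rw [Set.sdiff_inter]
    exact (hs (hCU.mono (Set.inter_subset_inter_right _ Set.inter_subset_left))).union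
      (ht (hCU.mono (Set.inter_subset_inter_right _ Set.inter_subset_right)))
  | sUnion S _ hS =>
    obtain ⟨z, hz, s, hs, hzs⟩ := hCU
    exact (hS s hs ⟨z, hz, hzs⟩).subset (Set.sdiff_subset_sdiff_right (Set.subset_sUnion_of_mem hs))

end CoordSpace

/-- An infinite space with the cofinite topology has Krull dimension one. -/
theorem topologicalKrullDim_eq_one_of_cofinite {T : Type*} [TopologicalSpace T] [T1Space T]
    [Infinite T] (h : ∀ s : Set T, IsClosed s → s ≠ Set.univ → s.Finite) :
    topologicalKrullDim T = 1 := by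
  have hirr : IsIrreducible (Set.univ : Set T) := by
    refine ⟨Set.univ_nonempty, fun u v hu hv ⟨x, _, hx⟩ ⟨y, _, hy⟩ => ?_⟩
    have h1 := h uᶜ hu.isClosed_compl (fun e => (e ▸ Set.mem_univ x : x ∈ uᶜ) hx)
    have h2 := h vᶜ hv.isClosed_compl (fun e => (e ▸ Set.mem_univ y : y ∈ vᶜ) hy)
    obtain ⟨z, hz⟩ := (h1.union h2).infinite_compl.nonempty
    exact ⟨z, trivial, by simpa using hz⟩
  apply le_antisymm
  · refine Order.krullDim_le_one_iff.mpr fun b => or_iff_not_imp_right.mpr fun hb a hab => ?_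
    -- an irreducible closed set that is not everything is finite, and finite `T1` spaces are
    -- discrete
    have hbfin : (b : Set T).Finite := by
      refine h _ b.isClosed fun hu => hb fun c _ x _ => ?_
      change x ∈ (b : Set T)
      rw [hu]; trivial
    have hsub : (b : Set T) ⊆ a ∪ (b \ a) := by simp
    rcases isPreirreducible_iff_isClosed_union_isClosed.mp b.isIrreducible.isPreirreducible
      a (b \ a) a.isClosed (hbfin.subset Set.sdiff_subset).isClosed hsub with h1 | h1
    · exact h1
    · obtain ⟨x, hx⟩ := a.isIrreducible.nonempty
      exact absurd hx (h1 (hab hx)).2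
  · obtain ⟨x⟩ : Nonempty T := inferInstance
    refine Order.one_le_krullDim_iff.mpr
      ⟨⟨{x}, isIrreducible_singleton, isClosed_singleton⟩, ⟨Set.univ, hirr, isClosed_univ⟩,
        lt_of_le_not_ge (fun y _ => Set.mem_univ y) fun hle => ?_⟩
    exact Set.infinite_univ ((Set.finite_singleton x).subset fun y hy => hle hy)

/-! ### Pure tensors and points of the Segre variety -/

theorem exists_smul_eq_of_minors {ι : Type*} {a b : ι → ℂ} (ha : a ≠ 0)
    (h : ∀ i k, a i * b k = a k * b i) : ∃ c : ℂ, b = c • a := by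
  obtain ⟨i, hi⟩ := Function.ne_iff.mp ha
  refine ⟨b i / a i, funext fun k => ?_⟩
  have := h i k
  simp only [Pi.smul_apply, smul_eq_mul, Pi.zero_apply] at *
  field_simp
  linear_combination this

variable {r s : ℕ}

theorem segreVec_smul_left (k : ℂ) (v : Fin (r + 1) → ℂ) (w : Fin (s + 1) → ℂ) :
    segreVec (k • v) w = k • segreVec v w := by
  ext; simp [segreVec, mul_assoc]

theorem segreVec_smul_right (k : ℂ) (v : Fin (r + 1) → ℂ) (w : Fin (s + 1) → ℂ) :
    segreVec v (k • w) = k • segreVec v w := by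
  ext; simp [segreVec, mul_left_comm]

theorem segreVec_add_left (v v' : Fin (r + 1) → ℂ) (w : Fin (s + 1) → ℂ) :
    segreVec (v + v') w = segreVec v w + segreVec v' w := by
  ext; simp [segreVec, add_mul]

theorem segreVec_add_right (v : Fin (r + 1) → ℂ) (w w' : Fin (s + 1) → ℂ) :
    segreVec v (w + w') = segreVec v w + segreVec v w' := by
  ext; simp [segreVec, mul_add]

@[simp] theorem segreVec_zero_left (w : Fin (s + 1) → ℂ) :
    segreVec (0 : Fin (r + 1) → ℂ) w = 0 := by
  ext; simp [segreVec]

@[simp] theorem segreVec_zero_right (v : Fin (r + 1) → ℂ) :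
    segreVec v (0 : Fin (s + 1) → ℂ) = 0 := by
  ext; simp [segreVec]

theorem segreVec_eq_zero_iff {v : Fin (r + 1) → ℂ} {w : Fin (s + 1) → ℂ} :
    segreVec v w = 0 ↔ v = 0 ∨ w = 0 := by
  refine ⟨fun h => ?_, by rintro (rfl | rfl) <;> simp⟩
  by_contra! hvw
  obtain ⟨i, hi⟩ := Function.ne_iff.mp hvw.1
  obtain ⟨j, hj⟩ := Function.ne_iff.mp hvw.2
  exact mul_ne_zero hi hj (congrFun h (i, j))

/-- A nonzero pure tensor determines its factors up to scalars. -/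
theorem exists_units_smul_of_segreVec_eq {v v' : Fin (r + 1) → ℂ} {w w' : Fin (s + 1) → ℂ} {k : ℂ}
    (hv : v ≠ 0) (hw : w ≠ 0) (h : segreVec v w = k • segreVec v' w') :
    ∃ c d : ℂˣ, v = (c : ℂ) • v' ∧ w = (d : ℂ) • w' := by
  obtain ⟨i, hi⟩ := Function.ne_iff.mp hv
  obtain ⟨j, hj⟩ := Function.ne_iff.mp hw
  simp only [Pi.zero_apply] at hi hj
  have hij : ∀ i j, v i * w j = k * (v' i * w' j) := fun i j => congrFun h (i, j)
  have h1 : v = (k * w' j / w j) • v' := by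
    ext l
    simp only [Pi.smul_apply, smul_eq_mul]
    field_simp
    linear_combination hij l j
  have h2 : w = (k * v' i / v i) • w' := by
    ext l
    simp only [Pi.smul_apply, smul_eq_mul]
    field_simp
    linear_combination hij i l
  have h3 : k * w' j / w j ≠ 0 := fun h0 => hv (by rw [h1, h0, zero_smul])
  have h4 : k * v' i / v i ≠ 0 := fun h0 => hw (by rw [h2, h0, zero_smul])
  exact ⟨.mk0 _ h3, .mk0 _ h4, h1, h2⟩

/-- If the sum of two pure tensors is pure, then they share a factor: a two by two minor of the sum
is the product of a minor of `(a, a')` and a minor of `(c, c')`. -/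
theorem exists_smul_of_segreVec_add_eq {a a' v : Fin (r + 1) → ℂ} {c c' w : Fin (s + 1) → ℂ}
    (ha : a ≠ 0) (hc : c ≠ 0) (h : segreVec a c + segreVec a' c' = segreVec v w) :
    (∃ k : ℂ, a' = k • a) ∨ ∃ k : ℂ, c' = k • c := by
  have hij : ∀ i j, a i * c j + a' i * c' j = v i * w j := fun i j => congrFun h (i, j)
  have key : ∀ i k j l, (a i * a' k - a k * a' i) * (c j * c' l - c l * c' j) = 0 := by
    intro i k j l
    have e : (a i * c j + a' i * c' j) * (a k * c l + a' k * c' l) -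
        (a i * c l + a' i * c' l) * (a k * c j + a' k * c' j) = 0 := by
      rw [hij, hij, hij, hij]; ring
    linear_combination e
  by_cases h1 : ∀ i k, a i * a' k = a k * a' i
  · exact .inl (exists_smul_eq_of_minors ha h1)
  · push Not at h1
    obtain ⟨i, k, hik⟩ := h1
    refine .inr (exists_smul_eq_of_minors hc fun j l => ?_)
    exact sub_eq_zero.mp ((mul_eq_zero.mp (key i k j l)).resolve_left (sub_ne_zero.mpr hik))

/-- The Segre image of a point, as a vector. -/
def segrePt (p : (biProj r s).Pt) : Fin (r + 1) × Fin (s + 1) → ℂ :=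
  segreVec ((projSpace r).coord p.1) ((projSpace s).coord p.2)

theorem coord_ne_zero (x : (projSpace r).Pt) : (projSpace r).coord x ≠ 0 :=
  Projectivization.rep_nonzero x

theorem segrePt_ne_zero (p : (biProj r s).Pt) : segrePt p ≠ 0 := fun h =>
  (segreVec_eq_zero_iff.mp h).elim (coord_ne_zero _) (coord_ne_zero _)

theorem pt_eq_of_coord_eq_smul {x y : (projSpace r).Pt} {k : ℂ}
    (h : (projSpace r).coord x = k • (projSpace r).coord y) : x = y := by
  have h' := (Projectivization.mk_eq_mk_iff' ℂ _ _ (Projectivization.rep_nonzero x)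
    (Projectivization.rep_nonzero y)).mpr ⟨k, h.symm⟩
  exact (Projectivization.mk_rep x).symm.trans (h'.trans (Projectivization.mk_rep y))

theorem exists_pt {v : Fin (r + 1) → ℂ} (hv : v ≠ 0) :
    ∃ (x : (projSpace r).Pt) (c : ℂˣ), (projSpace r).coord x = (c : ℂ) • v := by
  obtain ⟨c, hc⟩ := Projectivization.exists_smul_eq_mk_rep ℂ v hv
  exact ⟨Projectivization.mk ℂ v hv, c, hc.symm⟩

theorem eq_of_segrePt_eq_smul {p q : (biProj r s).Pt} {k : ℂ}
    (h : segrePt p = k • segrePt q) : p = q := by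
  obtain ⟨c, d, h1, h2⟩ := exists_units_smul_of_segreVec_eq (coord_ne_zero _) (coord_ne_zero _) h
  exact Prod.ext (pt_eq_of_coord_eq_smul h1) (pt_eq_of_coord_eq_smul h2)

theorem exists_segrePt_eq_smul {v : Fin (r + 1) → ℂ} {w : Fin (s + 1) → ℂ} (h : segreVec v w ≠ 0) :
    ∃ (p : (biProj r s).Pt) (c d : ℂˣ), (projSpace r).coord p.1 = (c : ℂ) • v ∧
      (projSpace s).coord p.2 = (d : ℂ) • w ∧
      segrePt p = ((c * d : ℂˣ) : ℂ) • segreVec v w := by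
  rw [Ne, segreVec_eq_zero_iff, not_or] at h
  obtain ⟨x, c, hx⟩ := exists_pt h.1
  obtain ⟨y, d, hy⟩ := exists_pt h.2
  refine ⟨(x, y), c, d, hx, hy, ?_⟩
  change segreVec ((projSpace r).coord x) ((projSpace s).coord y) = _
  rw [hx, hy, segreVec_smul_left, segreVec_smul_right, smul_smul, Units.val_mul]

theorem subsingleton_setOf_segrePt_mem_span (u : Fin (r + 1) × Fin (s + 1) → ℂ) :
    {p : (biProj r s).Pt | segrePt p ∈ Submodule.span ℂ {u}}.Subsingleton := by
  intro p hp q hq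
  obtain ⟨k, hk⟩ := Submodule.mem_span_singleton.mp hp
  obtain ⟨l, hl⟩ := Submodule.mem_span_singleton.mp hq
  have hl0 : l ≠ 0 := by rintro rfl; exact segrePt_ne_zero q (by simp [← hl])
  refine eq_of_segrePt_eq_smul (k := k * l⁻¹) ?_
  rw [← hk, ← hl, smul_smul, mul_assoc, inv_mul_cancel₀ hl0, mul_one]

/-! ### Forms of bidegree `(1, 1)` -/

/-- The bidegree `(1, 1)`, as an element of the degree monoid of the product. -/
def segreDeg (r s : ℕ) : (biProj r s).Deg := (((1 : ℕ), (1 : ℕ)) : ℕ × ℕ)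

/-- A pair of vectors, as a family indexed by the variables of the product. -/
def biVec (v : Fin (r + 1) → ℂ) (w : Fin (s + 1) → ℂ) : (biProj r s).Var → ℂ := Sum.elim v w

/-- The form of bidegree `(1, 1)` corresponding to a linear form on the target of the Segre map. -/
def segreForm (f : (Fin (r + 1) × Fin (s + 1) → ℂ) →ₗ[ℂ] ℂ) :
    MvPolynomial (biProj r s).Var ℂ :=
  ∑ p : Fin (r + 1) × Fin (s + 1), C (f (Pi.single p 1)) * (X (Sum.inl p.1) * X (Sum.inr p.2))

theorem isWeightedHomogeneous_segreForm (f : (Fin (r + 1) × Fin (s + 1) → ℂ) →ₗ[ℂ] ℂ) :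
    IsWeightedHomogeneous (biProj r s).wt (segreForm f) (segreDeg r s) := by
  refine IsWeightedHomogeneous.sum _ _ _ fun p _ => IsWeightedHomogeneous.C_mul ?_ _
  exact (isWeightedHomogeneous_X ℂ (biProj r s).wt (Sum.inl p.1)).mul
    (isWeightedHomogeneous_X ℂ (biProj r s).wt (Sum.inr p.2))

theorem eval_segreForm (f : (Fin (r + 1) × Fin (s + 1) → ℂ) →ₗ[ℂ] ℂ)
    (v : Fin (r + 1) → ℂ) (w : Fin (s + 1) → ℂ) :
    eval (biVec v w) (segreForm f) = f (segreVec v w) := by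
  change eval (Sum.elim v w) (∑ p : Fin (r + 1) × Fin (s + 1),
    (C (f (Pi.single p 1)) * (X (Sum.inl p.1) * X (Sum.inr p.2)) :
      MvPolynomial (Fin (r + 1) ⊕ Fin (s + 1)) ℂ)) = f (segreVec v w)
  rw [f.pi_apply_eq_sum_univ]
  simp only [map_sum, map_mul, eval_C, eval_X, Sum.elim_inl, Sum.elim_inr, segreVec,
    smul_eq_mul]
  exact Finset.sum_congr rfl fun p _ => by
    rw [mul_comm]; congr 2; ext q; simp [Pi.single_apply, eq_comm]

theorem eval_coord_segreForm (f : (Fin (r + 1) × Fin (s + 1) → ℂ) →ₗ[ℂ] ℂ) (p : (biProj r s).Pt) :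
    eval ((biProj r s).coord p) (segreForm f) = f (segrePt p) :=
  eval_segreForm f _ _

/-- The character of the monoid `ℕ × ℕ` of bidegrees with values `c` and `d` at the generators. -/
def biChar (c d : ℂˣ) : Multiplicative (ℕ × ℕ) →* ℂˣ where
  toFun e := c ^ e.toAdd.1 * d ^ e.toAdd.2
  map_one' := by simp
  map_mul' e f := by simp [pow_add, mul_mul_mul_comm]

/-- The vanishing of a form at a point may be tested on any choice of homogeneous coordinates. -/
theorem eval_coord_of_smul {F : MvPolynomial (biProj r s).Var ℂ} {e : (biProj r s).Deg}
    (hF : IsWeightedHomogeneous (biProj r s).wt F e) {p : (biProj r s).Pt} {c d : ℂˣ}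
    {v : Fin (r + 1) → ℂ} {w : Fin (s + 1) → ℂ}
    (hv : (projSpace r).coord p.1 = (c : ℂ) • v) (hw : (projSpace s).coord p.2 = (d : ℂ) • w) :
    eval ((biProj r s).coord p) F = 0 ↔ eval (biVec v w) F = 0 := by
  rw [CoordSpace.eval_of_scaled hF (biChar c d) (h := biVec v w)]
  · exact Units.mul_right_eq_zero _
  · rintro (i | j)
    · refine (congrFun hv i).trans ?_
      change (c : ℂ) * v i = ((c ^ 1 * d ^ 0 : ℂˣ) : ℂ) * v i
      simp
    · refine (congrFun hw j).trans ?_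
      change (d : ℂ) * w j = ((c ^ 0 * d ^ 1 : ℂˣ) : ℂ) * w j
      simp

/-! ### Parametrisation of the lines of the Segre variety -/

theorem finrank_span_pair_of_linearIndependent {V : Type*} [AddCommGroup V] [Module ℂ V] {u v : V}
    (h : LinearIndependent ℂ ![u, v]) : Module.finrank ℂ (Submodule.span ℂ {u, v}) = 2 := by
  rw [← Matrix.range_cons_cons_empty u v ![], finrank_span_eq_card h, Fintype.card_fin]

theorem span_pair_eq_of_finrank_eq_two {V : Type*} [AddCommGroup V] [Module ℂ V] {u v : V}
    {W : Submodule ℂ V} (hW : Module.finrank ℂ W = 2) (h : LinearIndependent ℂ ![u, v])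
    (hu : u ∈ W) (hv : v ∈ W) : Submodule.span ℂ {u, v} = W := by
  have : FiniteDimensional ℂ W := FiniteDimensional.of_finrank_pos (by omega)
  refine Submodule.eq_of_le_of_finrank_eq ?_ ?_
  · rw [Submodule.span_le]
    rintro x (rfl | rfl) <;> assumption
  · rw [hW, finrank_span_pair_of_linearIndependent h]

theorem exists_linearIndependent_pair_of_finrank_eq_two {V : Type*} [AddCommGroup V] [Module ℂ V]
    {W : Submodule ℂ V} (hW : Module.finrank ℂ W = 2) {u : V} (hu : u ∈ W) (hu0 : u ≠ 0) :
    ∃ v ∈ W, LinearIndependent ℂ ![u, v] := by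
  obtain ⟨v, hv⟩ := exists_linearIndependent_pair_of_one_lt_finrank (R := ℂ) (M := W)
    (by omega) (x := ⟨u, hu⟩) (by simpa using hu0)
  refine ⟨v, v.2, ?_⟩
  rw [LinearIndependent.pair_iff] at hv ⊢
  exact fun s t hst => hv s t (Subtype.ext hst)

/-- The subspace `W` is a projective line contained in the Segre variety. -/
def IsSegreLine (W : Submodule ℂ (Fin (r + 1) × Fin (s + 1) → ℂ)) : Prop :=
  Module.finrank ℂ W = 2 ∧ ∀ u ∈ W, ∃ v w, u = segreVec v w

/-- The points of `ℙ^r × ℙ^s` whose Segre image lies on the projective subspace given by `W`. -/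
def segrePreimage (W : Submodule ℂ (Fin (r + 1) × Fin (s + 1) → ℂ)) : Set (biProj r s).Pt :=
  {p | segrePt p ∈ W}

theorem mem_segrePreimage {W : Submodule ℂ (Fin (r + 1) × Fin (s + 1) → ℂ)}
    {p : (biProj r s).Pt} : p ∈ segrePreimage W ↔ segrePt p ∈ W := Iff.rfl

/-- The affine parametrisation `t ↦ (a + t a', c + t c')`, in which one of the two components is
constant, is mapped by the Segre map to an affine parametrisation of the projective line given
by `W`; it covers the line up to one point. -/
structure IsSegreParam (W : Submodule ℂ (Fin (r + 1) × Fin (s + 1) → ℂ))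
    (a a' : Fin (r + 1) → ℂ) (c c' : Fin (s + 1) → ℂ) : Prop where
  linearIndependent : LinearIndependent ℂ ![segreVec a c, segreVec a' c + segreVec a c']
  eq_zero_or_eq_zero : a' = 0 ∨ c' = 0
  span_eq : Submodule.span ℂ {segreVec a c, segreVec a' c + segreVec a c'} = W

/-- Every nonzero vector of a Segre line is the starting point of a parametrisation: a second basis vector
shares a factor with it, and can be written with this same factor. -/
theorem IsSegreLine.exists_param {W : Submodule ℂ (Fin (r + 1) × Fin (s + 1) → ℂ)}
    (hW : IsSegreLine W) {a : Fin (r + 1) → ℂ} {c : Fin (s + 1) → ℂ} (hac : segreVec a c ∈ W)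
    (h0 : segreVec a c ≠ 0) : ∃ a' c', IsSegreParam W a a' c c' := by
  obtain ⟨u, hu, hli⟩ := exists_linearIndependent_pair_of_finrank_eq_two hW.1 hac h0
  obtain ⟨a', c', rfl⟩ := hW.2 u hu
  obtain ⟨v, w, hvw⟩ := hW.2 _ (W.add_mem hac hu)
  have hspan := span_pair_eq_of_finrank_eq_two hW.1 hli hac hu
  rw [Ne, segreVec_eq_zero_iff, not_or] at h0
  rcases exists_smul_of_segreVec_add_eq h0.1 h0.2 hvw with ⟨k, rfl⟩ | ⟨k, rfl⟩
  · have e : segreVec (0 : Fin (r + 1) → ℂ) c + segreVec a (k • c') = segreVec (k • a) c' := by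
      rw [segreVec_smul_left, segreVec_smul_right, segreVec_zero_left, zero_add]
    exact ⟨0, k • c', by rwa [e], .inl rfl, by rwa [e]⟩
  · have e : segreVec (k • a') c + segreVec a (0 : Fin (s + 1) → ℂ) = segreVec a' (k • c) := by
      rw [segreVec_smul_left, segreVec_smul_right, segreVec_zero_right, add_zero]
    exact ⟨k • a', 0, by rwa [e], .inr rfl, by rwa [e]⟩

theorem IsSegreLine.exists_param_of_mem {W : Submodule ℂ (Fin (r + 1) × Fin (s + 1) → ℂ)}
    (hW : IsSegreLine W) {p : (biProj r s).Pt} (hp : p ∈ segrePreimage W) :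
    ∃ a' c', IsSegreParam W ((projSpace r).coord p.1) a' ((projSpace s).coord p.2) c' :=
  hW.exists_param hp (segrePt_ne_zero p)

theorem IsSegreLine.nonempty {W : Submodule ℂ (Fin (r + 1) × Fin (s + 1) → ℂ)}
    (hW : IsSegreLine W) : (segrePreimage W).Nonempty := by
  have : Nontrivial W := Module.nontrivial_of_finrank_pos (R := ℂ) (by rw [hW.1]; omega)
  obtain ⟨u, hu⟩ := exists_ne (0 : W)
  obtain ⟨v, w, h⟩ := hW.2 _ u.2
  have h0 : segreVec v w ≠ 0 := by rw [← h]; simpa using hu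
  obtain ⟨p, c, d, -, -, hp⟩ := exists_segrePt_eq_smul h0
  exact ⟨p, by rw [mem_segrePreimage, hp, ← h]; exact W.smul_mem _ u.2⟩

section Poly
open Polynomial

/-- The polynomial substitution belonging to the parametrisation `t ↦ (a + t a', c + t c')`. -/
def paramPoly (a a' : Fin (r + 1) → ℂ) (c c' : Fin (s + 1) → ℂ) :
    (biProj r s).Var → ℂ[X] :=
  Sum.elim (fun i => Polynomial.C (a i) + Polynomial.X * Polynomial.C (a' i))
    (fun j => Polynomial.C (c j) + Polynomial.X * Polynomial.C (c' j))

theorem eval_aeval_paramPoly (a a' : Fin (r + 1) → ℂ) (c c' : Fin (s + 1) → ℂ)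
    (F : MvPolynomial (biProj r s).Var ℂ) (t : ℂ) :
    (MvPolynomial.aeval (paramPoly a a' c c') F).eval t =
      MvPolynomial.eval (biVec (a + t • a') (c + t • c')) F := by
  rw [← Polynomial.coe_aeval_eq_eval, MvPolynomial.comp_aeval_apply, ← MvPolynomial.aeval_eq_eval]
  congr 2
  ext (i | j)
  · change Polynomial.aeval t (Polynomial.C (a i) + Polynomial.X * Polynomial.C (a' i)) =
      a i + t * a' i
    simp [mul_comm t]
  · change Polynomial.aeval t (Polynomial.C (c j) + Polynomial.X * Polynomial.C (c' j)) =
      c j + t * c' j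
    simp [mul_comm t]

theorem eval_zero_aeval_paramPoly (a a' : Fin (r + 1) → ℂ) (c c' : Fin (s + 1) → ℂ)
    (F : MvPolynomial (biProj r s).Var ℂ) :
    (MvPolynomial.aeval (paramPoly a a' c c') F).eval 0 = MvPolynomial.eval (biVec a c) F := by
  simpa using eval_aeval_paramPoly a a' c c' F 0

end Poly

namespace IsSegreParam

variable {W : Submodule ℂ (Fin (r + 1) × Fin (s + 1) → ℂ)}
  {a a' : Fin (r + 1) → ℂ} {c c' : Fin (s + 1) → ℂ}

theorem segreVec_eq (h : IsSegreParam W a a' c c') (t : ℂ) :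
    segreVec (a + t • a') (c + t • c') =
      segreVec a c + t • (segreVec a' c + segreVec a c') := by
  rcases h.eq_zero_or_eq_zero with rfl | rfl
  · simp [segreVec_add_right, segreVec_smul_right]
  · simp [segreVec_add_left, segreVec_smul_left]

theorem segreVec_ne_zero (h : IsSegreParam W a a' c c') (t : ℂ) :
    segreVec (a + t • a') (c + t • c') ≠ 0 := by
  rw [h.segreVec_eq]
  intro h0
  have := LinearIndependent.pair_iff.mp h.linearIndependent 1 t (by rwa [one_smul])
  exact one_ne_zero this.1

theorem segreVec_mem (h : IsSegreParam W a a' c c') (t : ℂ) :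
    segreVec (a + t • a') (c + t • c') ∈ W := by
  rw [h.segreVec_eq, ← h.span_eq]
  exact Submodule.mem_span_pair.mpr ⟨1, t, by rw [one_smul]⟩

theorem exists_pt (h : IsSegreParam W a a' c c') (t : ℂ) : ∃ p ∈ segrePreimage W, ∃ d e : ℂˣ,
    (projSpace r).coord p.1 = (d : ℂ) • (a + t • a') ∧
    (projSpace s).coord p.2 = (e : ℂ) • (c + t • c') ∧
    segrePt p = ((d * e : ℂˣ) : ℂ) • segreVec (a + t • a') (c + t • c') := by
  obtain ⟨p, d, e, h1, h2, h3⟩ := exists_segrePt_eq_smul (h.segreVec_ne_zero t)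
  refine ⟨p, ?_, d, e, h1, h2, h3⟩
  rw [mem_segrePreimage, h3]
  exact W.smul_mem _ (h.segreVec_mem t)

theorem exists_param_of_notMem (h : IsSegreParam W a a' c c') {p : (biProj r s).Pt}
    (hp : p ∈ segrePreimage W)
    (hp' : segrePt p ∉ Submodule.span ℂ {segreVec a' c + segreVec a c'}) :
    ∃ t : ℂ, segrePt p ∈ Submodule.span ℂ {segreVec (a + t • a') (c + t • c')} ∧ ∃ d e : ℂˣ,
      (projSpace r).coord p.1 = (d : ℂ) • (a + t • a') ∧
      (projSpace s).coord p.2 = (e : ℂ) • (c + t • c') := by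
  rw [mem_segrePreimage, ← h.span_eq] at hp
  obtain ⟨α, β, hαβ⟩ := Submodule.mem_span_pair.mp hp
  have hα : α ≠ 0 := by
    rintro rfl
    exact hp' (Submodule.mem_span_singleton.mpr ⟨β, by simpa using hαβ⟩)
  have key : segrePt p = α • segreVec (a + (β / α) • a') (c + (β / α) • c') := by
    rw [h.segreVec_eq, smul_add, smul_smul, mul_div_cancel₀ _ hα, hαβ]
  refine ⟨β / α, Submodule.mem_span_singleton.mpr ⟨α, key.symm⟩, ?_⟩
  exact exists_units_smul_of_segreVec_eq (coord_ne_zero _) (coord_ne_zero _) key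

theorem infinite (h : IsSegreParam W a a' c c') : (segrePreimage W).Infinite := by
  choose P hPW d e _ _ hP using h.exists_pt
  refine Set.infinite_of_injective_forall_mem (f := P) (fun t t' htt => ?_) hPW
  have h1 := hP t
  rw [htt, hP t', h.segreVec_eq, h.segreVec_eq, smul_add _ _ (t' • _), smul_add _ _ (t • _),
    smul_smul, smul_smul] at h1
  obtain ⟨h2, h3⟩ := h.linearIndependent.eq_of_pair h1
  rw [h2] at h3
  exact (mul_left_cancel₀ (d t * e t).ne_zero h3).symm

/-- A form that does not vanish identically along the parametrisation has finitely many zeros on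
the line. -/
theorem finite_zeros (h : IsSegreParam W a a' c c') {F : MvPolynomial (biProj r s).Var ℂ}
    {d : (biProj r s).Deg} (hF : IsWeightedHomogeneous (biProj r s).wt F d)
    (h0 : aeval (paramPoly a a' c c') F ≠ 0) :
    {p ∈ segrePreimage W | eval ((biProj r s).coord p) F = 0}.Finite := by
  refine (((subsingleton_setOf_segrePt_mem_span (segreVec a' c + segreVec a c')).finite).union
    ((aeval (paramPoly a a' c c') F).roots.toFinset.finite_toSet.biUnion fun t _ =>
      (subsingleton_setOf_segrePt_mem_span (segreVec (a + t • a') (c + t • c'))).finite)).subset ?_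
  rintro p ⟨hp, hpF⟩
  by_cases hp' : segrePt p ∈ Submodule.span ℂ {segreVec a' c + segreVec a c'}
  · exact .inl hp'
  · obtain ⟨t, ht, d, e, h1, h2⟩ := h.exists_param_of_notMem hp hp'
    refine .inr (Set.mem_biUnion (x := t) ?_ ht)
    rw [eval_coord_of_smul hF h1 h2] at hpF
    rw [Finset.mem_coe, Multiset.mem_toFinset, Polynomial.mem_roots h0]
    exact (eval_aeval_paramPoly a a' c c' F t).trans hpF

/-- The kernel of the restriction to the parametrisation consists of the forms that vanish on the
line. -/
theorem aeval_eq_zero_iff (h : IsSegreParam W a a' c c') {F : MvPolynomial (biProj r s).Var ℂ}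
    {d : (biProj r s).Deg} (hF : IsWeightedHomogeneous (biProj r s).wt F d)
    (hz : ∀ z ∈ segrePreimage W, eval ((biProj r s).coord z) F ≠ 0 →
      {p ∈ segrePreimage W | eval ((biProj r s).coord p) F = 0}.Finite) :
    aeval (paramPoly a a' c c') F = 0 ↔
      ∀ z ∈ segrePreimage W, eval ((biProj r s).coord z) F = 0 := by
  refine ⟨fun h0 => ?_, fun h0 => ?_⟩
  · -- all points of the line except possibly one are zeros
    by_contra! hne
    obtain ⟨z, hzW, hz0⟩ := hne
    refine h.infinite (((hz z hzW hz0).union (subsingleton_setOf_segrePt_mem_span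
      (segreVec a' c + segreVec a c')).finite).subset fun p hp => ?_)
    by_cases hp' : segrePt p ∈ Submodule.span ℂ {segreVec a' c + segreVec a c'}
    · exact .inr hp'
    · obtain ⟨t, -, d, e, h1, h2⟩ := h.exists_param_of_notMem hp hp'
      refine .inl ⟨hp, ?_⟩
      rw [eval_coord_of_smul hF h1 h2]
      exact (eval_aeval_paramPoly a a' c c' F t).symm.trans (by rw [h0, Polynomial.eval_zero])
  · by_contra hne
    exact h.infinite ((h.finite_zeros hF hne).subset fun p hp => ⟨hp, h0 p hp⟩)

end IsSegreParam

theorem IsSegreLine.finite_zeros {W : Submodule ℂ (Fin (r + 1) × Fin (s + 1) → ℂ)}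
    (hW : IsSegreLine W) (d : (biProj r s).Deg) (F : MvPolynomial (biProj r s).Var ℂ)
    (hF : IsWeightedHomogeneous (biProj r s).wt F d) (z : (biProj r s).Pt)
    (hz : z ∈ segrePreimage W) (hzF : eval ((biProj r s).coord z) F ≠ 0) :
    {p ∈ segrePreimage W | eval ((biProj r s).coord p) F = 0}.Finite := by
  obtain ⟨a', c', h⟩ := hW.exists_param_of_mem hz
  refine h.finite_zeros hF fun h0 => hzF ?_
  exact (eval_zero_aeval_paramPoly _ a' _ c' F).symm.trans (by rw [h0, Polynomial.eval_zero])

theorem IsSegreLine.infinite {W : Submodule ℂ (Fin (r + 1) × Fin (s + 1) → ℂ)}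
    (hW : IsSegreLine W) : (segrePreimage W).Infinite := by
  obtain ⟨p, hp⟩ := hW.nonempty
  obtain ⟨a', c', h⟩ := hW.exists_param_of_mem hp
  exact h.infinite

theorem IsSegreLine.segreSpan_segrePreimage {W : Submodule ℂ (Fin (r + 1) × Fin (s + 1) → ℂ)}
    (hW : IsSegreLine W) : segreSpan (segrePreimage W) = W := by
  refine le_antisymm (Submodule.span_le.mpr ?_) fun u hu => ?_
  · rintro _ ⟨p, hp, rfl⟩
    exact hp
  · by_cases h0 : u = 0
    · rw [h0]; exact Submodule.zero_mem _
    obtain ⟨v, w, rfl⟩ := hW.2 u hu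
    obtain ⟨p, c, d, -, -, hp⟩ := exists_segrePt_eq_smul h0
    have hpW : p ∈ segrePreimage W := by
      rw [mem_segrePreimage, hp]; exact W.smul_mem _ hu
    have : segreVec v w = ((c * d)⁻¹ : ℂˣ) • segrePt p := by
      rw [hp]; exact (inv_smul_smul (c * d) _).symm
    rw [this]
    exact Submodule.smul_mem _ _ (Submodule.subset_span ⟨p, hpW, rfl⟩)

/-! ### The lines of the Segre variety are lines of the product -/

theorem isClosed_segrePreimage (W : Submodule ℂ (Fin (r + 1) × Fin (s + 1) → ℂ)) :
    IsClosed (segrePreimage W) := by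
  rw [← isOpen_compl_iff, isOpen_iff_forall_mem_open]
  intro p hp
  obtain ⟨f, hf, hWf⟩ := Submodule.exists_le_ker_of_notMem hp
  refine ⟨{q | eval ((biProj r s).coord q) (segreForm f) ≠ 0}, fun q hq hqW => hq ?_,
    (biProj r s).isOpen_ne_zero (isWeightedHomogeneous_segreForm f), ?_⟩
  · rw [eval_coord_segreForm]
    exact hWf hqW
  · rw [Set.mem_ofPred, eval_coord_segreForm]
    exact hf

theorem segrePreimage_span_segrePt (p : (biProj r s).Pt) :
    segrePreimage (Submodule.span ℂ {segrePt p}) = {p} :=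
  (subsingleton_setOf_segrePt_mem_span _).eq_singleton_of_mem
    (Submodule.mem_span_singleton_self (segrePt p))

instance instT1SpaceBiProj : T1Space (biProj r s).Pt :=
  ⟨fun p => segrePreimage_span_segrePt p ▸ isClosed_segrePreimage _⟩

namespace IsSegreLine

variable {W : Submodule ℂ (Fin (r + 1) × Fin (s + 1) → ℂ)}

theorem finite_diff (hW : IsSegreLine W) {U : Set (biProj r s).Pt} (hU : IsOpen U)
    (h : (segrePreimage W ∩ U).Nonempty) : (segrePreimage W \ U).Finite :=
  CoordSpace.finite_diff_of_isOpen hW.finite_zeros hU h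

/-- An infinite Zariski closed subset of the line given by `W` is the whole line. -/
theorem eq_of_isClosed_of_infinite (hW : IsSegreLine W) {C : Set (biProj r s).Pt}
    (hC : IsClosed C) (hCW : C ⊆ segrePreimage W) (hinf : C.Infinite) : C = segrePreimage W := by
  refine hCW.antisymm fun p hp => ?_
  by_contra hpC
  refine hinf ((hW.finite_diff hC.isOpen_compl ⟨p, hp, hpC⟩).subset fun q hq => ?_)
  exact ⟨hCW hq, fun h => h hq⟩

theorem isIrreducibleCurve (hW : IsSegreLine W) :
    (biProj r s).IsIrreducibleCurve (segrePreimage W) := by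
  refine ⟨isClosed_segrePreimage W, ⟨hW.nonempty, fun u v hu hv h1 h2 => ?_⟩, ?_⟩
  · have := (hW.infinite.sdiff (hW.finite_diff hu h1)).sdiff (hW.finite_diff hv h2)
    obtain ⟨p, ⟨hp, hpu⟩, hpv⟩ := this.nonempty
    refine ⟨p, hp, ?_, ?_⟩
    · by_contra h; exact hpu ⟨hp, h⟩
    · by_contra h; exact hpv ⟨hp, h⟩
  · have : Infinite (segrePreimage W) := hW.infinite.to_subtype
    refine topologicalKrullDim_eq_one_of_cofinite fun S hS hne => ?_
    obtain ⟨K, hK, rfl⟩ := isClosed_induced_iff.mp hS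
    by_contra hinf
    refine hne ?_
    have h1 : (K ∩ segrePreimage W).Infinite := by
      rw [Set.inter_comm, ← Subtype.image_preimage_coe]
      exact Set.Infinite.image Subtype.val_injective.injOn hinf
    have := hW.eq_of_isClosed_of_infinite (hK.inter (isClosed_segrePreimage W))
      Set.inter_subset_right h1
    ext p
    simp only [Set.mem_preimage, Set.mem_univ, iff_true]
    exact (this.symm ▸ p.2 : (p : (biProj r s).Pt) ∈ K ∩ segrePreimage W).1

end IsSegreLine

theorem finrank_map_eq_of_ker_eq {V V₁ V₂ : Type*} [AddCommGroup V] [Module ℂ V]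
    [AddCommGroup V₁] [Module ℂ V₁] [AddCommGroup V₂] [Module ℂ V₂] (M : Submodule ℂ V)
    (f : V →ₗ[ℂ] V₁) (g : V →ₗ[ℂ] V₂) (h : ∀ x ∈ M, f x = 0 ↔ g x = 0) :
    Module.finrank ℂ (M.map f) = Module.finrank ℂ (M.map g) := by
  have hker : LinearMap.ker (f.domRestrict M) = LinearMap.ker (g.domRestrict M) := by
    ext x; exact h x x.2
  rw [← LinearMap.range_domRestrict, ← LinearMap.range_domRestrict]
  exact ((f.domRestrict M).quotKerEquivRange.symm.trans
    ((Submodule.quotEquivOfEq _ _ hker).trans (g.domRestrict M).quotKerEquivRange)).finrank_eq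

theorem IsSegreParam.aeval_segreForm {W : Submodule ℂ (Fin (r + 1) × Fin (s + 1) → ℂ)}
    {a a' : Fin (r + 1) → ℂ} {c c' : Fin (s + 1) → ℂ} (h : IsSegreParam W a a' c c')
    (f : (Fin (r + 1) × Fin (s + 1) → ℂ) →ₗ[ℂ] ℂ) :
    aeval (paramPoly a a' c c') (segreForm f) = Polynomial.C (f (segreVec a c)) +
      Polynomial.X * Polynomial.C (f (segreVec a' c + segreVec a c')) := by
  refine Polynomial.funext fun t => ?_
  rw [eval_aeval_paramPoly, eval_segreForm, h.segreVec_eq, map_add, map_smul]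
  simp

/-- For linearly independent `u`, `v` there is a linear form with values `1` and `0`. -/
theorem exists_dual_of_linearIndependent_pair {V : Type*} [AddCommGroup V] [Module ℂ V] {u v : V}
    (h : LinearIndependent ℂ ![u, v]) : ∃ f : V →ₗ[ℂ] ℂ, f u = 1 ∧ f v = 0 := by
  have hu : u ∉ Submodule.span ℂ {v} := by
    intro hu
    obtain ⟨k, hk⟩ := Submodule.mem_span_singleton.mp hu
    have := LinearIndependent.pair_iff.mp h 1 (-k) (by rw [← hk]; module)
    exact one_ne_zero this.1
  obtain ⟨f, hf, hv⟩ := Submodule.exists_le_ker_of_notMem hu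
  refine ⟨(f u)⁻¹ • f, by simp [hf], ?_⟩
  have : f v = 0 := hv (Submodule.mem_span_singleton_self v)
  simp [this]

theorem isWeightedHomogeneous_segreForm_pow (f : (Fin (r + 1) × Fin (s + 1) → ℂ) →ₗ[ℂ] ℂ) (t : ℕ) :
    IsWeightedHomogeneous (biProj r s).wt (segreForm f ^ t) (t • segreDeg r s) :=
  (isWeightedHomogeneous_segreForm f).pow t

/-- The forms of bidegree `(t, t)` restrict to the polynomials of degree at most `t` in the
parameter of the line. -/
theorem IsSegreParam.map_aeval {W : Submodule ℂ (Fin (r + 1) × Fin (s + 1) → ℂ)}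
    {a a' : Fin (r + 1) → ℂ} {c c' : Fin (s + 1) → ℂ} (h : IsSegreParam W a a' c c') (t : ℕ) :
    (weightedHomogeneousSubmodule ℂ (biProj r s).wt (t • segreDeg r s)).map
      (aeval (paramPoly a a' c c')).toLinearMap = Polynomial.degreeLT ℂ (t + 1) := by
  apply le_antisymm
  · rintro _ ⟨F, hF, rfl⟩
    rw [Polynomial.mem_degreeLT]
    suffices hdeg : (aeval (paramPoly a a' c c') F).natDegree ≤ t from
      (Polynomial.degree_le_natDegree.trans (Nat.cast_le.mpr hdeg)).trans_lt
        (Nat.cast_lt.mpr t.lt_succ_self)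
    have hlin : ∀ z z' : ℂ, (Polynomial.C z + Polynomial.X * Polynomial.C z').natDegree ≤ 1 := by
      intro z z'
      compute_degree
    have hconst : ∀ z : ℂ, (Polynomial.C z + Polynomial.X * Polynomial.C 0).natDegree ≤ 0 := by
      simp
    rcases h.eq_zero_or_eq_zero with rfl | rfl
    · have := CoordSpace.natDegree_aeval_le (w := (biProj r s).wt) hF (AddMonoidHom.snd ℕ ℕ)
        (P := paramPoly a 0 c c') (by
          rintro (i | j)
          · exact hconst _
          · exact hlin _ _)
      exact this.trans (le_of_eq t.mul_one)
    · have := CoordSpace.natDegree_aeval_le (w := (biProj r s).wt) hF (AddMonoidHom.fst ℕ ℕ)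
        (P := paramPoly a a' c 0) (by
          rintro (i | j)
          · exact hlin _ _
          · exact hconst _)
      exact this.trans (le_of_eq t.mul_one)
  · obtain ⟨f, hf1, hf2⟩ := exists_dual_of_linearIndependent_pair h.linearIndependent
    obtain ⟨g, hg1, hg2⟩ := exists_dual_of_linearIndependent_pair
      (LinearIndependent.pair_symm_iff.mp h.linearIndependent)
    have hf : aeval (paramPoly a a' c c') (segreForm f) = 1 := by
      simp [h.aeval_segreForm, hf1, hf2]
    have hg : aeval (paramPoly a a' c c') (segreForm g) = Polynomial.X := by
      simp [h.aeval_segreForm, hg1, hg2]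
    classical
    rw [Polynomial.degreeLT_eq_span_X_pow, Submodule.span_le]
    intro _ hk
    simp only [Finset.coe_image, Set.mem_image, Finset.mem_coe, Finset.mem_range] at hk
    obtain ⟨k, hk, rfl⟩ := hk
    refine ⟨segreForm f ^ (t - k) * segreForm g ^ k, ?_, ?_⟩
    · have := (isWeightedHomogeneous_segreForm_pow f (t - k)).mul
        (isWeightedHomogeneous_segreForm_pow g k)
      rw [← add_smul, Nat.sub_add_cancel (by omega)] at this
      exact this
    · rw [AlgHom.toLinearMap_apply, map_mul, map_pow, map_pow, hf, hg, one_pow, one_mul]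

theorem IsSegreLine.hilbertFunction_eq {W : Submodule ℂ (Fin (r + 1) × Fin (s + 1) → ℂ)}
    (hW : IsSegreLine W) (t : ℕ) :
    (biProj r s).hilbertFunction (segrePreimage W) (t • segreDeg r s) = t + 1 := by
  obtain ⟨p, hp⟩ := hW.nonempty
  obtain ⟨a', c', h⟩ := hW.exists_param_of_mem hp
  unfold CoordSpace.hilbertFunction
  refine (finrank_map_eq_of_ker_eq _ _ (aeval (paramPoly ((projSpace r).coord p.1) a'
    ((projSpace s).coord p.2) c')).toLinearMap fun F hF => ?_).trans ?_
  · rw [AlgHom.toLinearMap_apply, h.aeval_eq_zero_iff hF fun z => hW.finite_zeros _ F hF z]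
    simp [CoordSpace.evalOn, funext_iff]
  · rw [h.map_aeval, (Polynomial.degreeLTEquiv ℂ (t + 1)).finrank_eq]
    simp

theorem IsSegreLine.isLineInBiProj {W : Submodule ℂ (Fin (r + 1) × Fin (s + 1) → ℂ)}
    (hW : IsSegreLine W) : IsLineInBiProj r s (segrePreimage W) :=
  ⟨hW.isIrreducibleCurve, 1, .of_forall fun t =>
    (congrArg Nat.cast (hW.hilbertFunction_eq t)).trans (by push_cast; rw [one_mul])⟩

/-! ### Curves of degree one are lines of the Segre variety -/

theorem finrank_add_two_le {V : Type*} [AddCommGroup V] [Module ℂ V] {K S : Submodule ℂ V}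
    [FiniteDimensional ℂ S] (hKS : K ≤ S) (ψ : V →ₗ[ℂ] ℂ × ℂ) (hK : ∀ x ∈ K, ψ x = 0)
    {g₁ g₂ : V} (h₁ : g₁ ∈ S) (h₂ : g₂ ∈ S) (hg₁ : ψ g₁ = (1, 0)) (hg₂ : ψ g₂ = (0, 1)) :
    Module.finrank ℂ K + 2 ≤ Module.finrank ℂ S := by
  have hsurj : LinearMap.range (ψ.domRestrict S) = ⊤ := by
    refine LinearMap.range_eq_top.mpr fun ⟨x, y⟩ => ⟨x • ⟨g₁, h₁⟩ + y • ⟨g₂, h₂⟩, ?_⟩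
    simp [hg₁, hg₂]
  have hle : K.comap S.subtype ≤ LinearMap.ker (ψ.domRestrict S) := fun x hx => hK x hx
  have h1 := LinearMap.finrank_range_add_finrank_ker (ψ.domRestrict S)
  have h2 := Submodule.finrank_mono hle
  rw [(Submodule.comapSubtypeEquivOfLe hKS).finrank_eq] at h2
  rw [hsurj, finrank_top, Module.finrank_prod, Module.finrank_self] at h1
  omega

theorem linearIndependent_segrePt {p q : (biProj r s).Pt} (hpq : p ≠ q) :
    LinearIndependent ℂ ![segrePt p, segrePt q] :=
  (LinearIndependent.pair_iff' (segrePt_ne_zero p)).mpr fun _ h =>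
    hpq (eq_of_segrePt_eq_smul h.symm).symm

/-- On an irreducible set, a product of two forms vanishes only if one of the factors does. -/
theorem CoordSpace.eval_eq_zero_of_mul {X : CoordSpace} {C : Set X.Pt} (hC : IsIrreducible C)
    {F G : MvPolynomial X.Var ℂ} {d e : X.Deg} (hF : IsWeightedHomogeneous X.wt F d)
    (hG : IsWeightedHomogeneous X.wt G e) {z : X.Pt} (hz : z ∈ C) (hzF : eval (X.coord z) F ≠ 0)
    (hFG : ∀ w ∈ C, eval (X.coord w) F * eval (X.coord w) G = 0) :
    ∀ w ∈ C, eval (X.coord w) G = 0 := by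
  intro w hw
  by_contra hwG
  obtain ⟨y, hy, hyF, hyG⟩ := hC.2 _ _ (X.isOpen_ne_zero hF) (X.isOpen_ne_zero hG)
    ⟨z, hz, hzF⟩ ⟨w, hw, hwG⟩
  exact mul_ne_zero hyF hyG (hFG y hy)

/-- The Hilbert function of a finite set of points is bounded by their number, whereas that of a
curve of degree one is unbounded. -/
theorem infinite_of_hasDegree_one {C : Set (biProj r s).Pt}
    (hC : (biProj r s).HasDegree (segreDeg r s) C 1) : C.Infinite := by
  intro hfin
  have := hfin.fintype
  obtain ⟨k, hk⟩ := hC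
  obtain ⟨t, ht, hle⟩ := (hk.and (eventually_ge_atTop (Fintype.card C + 1 + k.natAbs))).exists
  have h1 : (biProj r s).hilbertFunction C (t • segreDeg r s) ≤ Fintype.card C :=
    (Submodule.finrank_le _).trans_eq (Module.finrank_fintype_fun_eq_card ℂ)
  omega

/-- On a curve of degree one, a form of bidegree `(1, 1)` that vanishes at two points vanishes
everywhere. Otherwise multiplication by it embeds the degree `t` part of the coordinate ring into
the part of degree `t + 1`, with image in the kernel of the evaluation at the two points, and the
Hilbert function would increase by at least two. -/
theorem eq_zero_of_apply_segrePt_eq_zero {C : Set (biProj r s).Pt} (hirr : IsIrreducible C)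
    (hC : (biProj r s).HasDegree (segreDeg r s) C 1) {p q : (biProj r s).Pt} (hp : p ∈ C)
    (hq : q ∈ C) (hpq : p ≠ q) {f : (Fin (r + 1) × Fin (s + 1) → ℂ) →ₗ[ℂ] ℂ}
    (hfp : f (segrePt p) = 0) (hfq : f (segrePt q) = 0) : ∀ z ∈ C, f (segrePt z) = 0 := by
  by_contra! hne
  obtain ⟨z, hz, hfz⟩ := hne
  obtain ⟨k, hk⟩ := hC
  obtain ⟨t, ⟨ht, hpos⟩, ht'⟩ := ((hk.and (eventually_ge_atTop (1 + k.natAbs))).and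
    ((tendsto_add_atTop_nat 1).eventually hk)).exists
  have hpos' : 0 < (biProj r s).hilbertFunction C ((t + 1) • segreDeg r s) := by omega
  have hfd : FiniteDimensional ℂ ((weightedHomogeneousSubmodule ℂ (biProj r s).wt
      ((t + 1) • segreDeg r s)).map ((biProj r s).evalOn C)) :=
    FiniteDimensional.of_finrank_pos hpos'
  obtain ⟨g₁, hg₁, hg₁'⟩ := exists_dual_of_linearIndependent_pair (linearIndependent_segrePt hpq)
  obtain ⟨g₂, hg₂, hg₂'⟩ :=
    exists_dual_of_linearIndependent_pair (linearIndependent_segrePt hpq.symm)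
  let ψ : (C → ℂ) →ₗ[ℂ] ℂ × ℂ :=
    (LinearMap.proj (⟨p, hp⟩ : C)).prod (LinearMap.proj (⟨q, hq⟩ : C))
  let μ : MvPolynomial (biProj r s).Var ℂ →ₗ[ℂ] (C → ℂ) :=
    (biProj r s).evalOn C ∘ₗ LinearMap.mulLeft ℂ (segreForm f)
  have hμ : ∀ F x, μ F x = f (segrePt x.1) * eval ((biProj r s).coord x.1) F := fun F x => by
    rw [← eval_coord_segreForm, ← map_mul]; rfl
  have hμle : (weightedHomogeneousSubmodule ℂ (biProj r s).wt (t • segreDeg r s)).map μ ≤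
      (weightedHomogeneousSubmodule ℂ (biProj r s).wt
        ((t + 1) • segreDeg r s)).map ((biProj r s).evalOn C) := by
    rintro _ ⟨F, hF, rfl⟩
    refine ⟨segreForm f * F, ?_, rfl⟩
    rw [add_smul, one_smul, add_comm]
    exact (isWeightedHomogeneous_segreForm f).mul hF
  have hpow : ∀ g x, (biProj r s).evalOn C (segreForm g ^ (t + 1)) x =
      g (segrePt x.1) ^ (t + 1) := fun g x => by
    rw [← eval_coord_segreForm, ← map_pow]; rfl
  have key := finrank_add_two_le hμle ψ (by
      rintro _ ⟨F, -, rfl⟩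
      exact Prod.ext ((hμ F ⟨p, hp⟩).trans (by rw [hfp, zero_mul]; rfl))
        ((hμ F ⟨q, hq⟩).trans (by rw [hfq, zero_mul]; rfl)))
    ⟨_, isWeightedHomogeneous_segreForm_pow g₁ (t + 1), rfl⟩
    ⟨_, isWeightedHomogeneous_segreForm_pow g₂ (t + 1), rfl⟩
    (Prod.ext ((hpow g₁ ⟨p, hp⟩).trans (by simp [hg₁]))
      ((hpow g₁ ⟨q, hq⟩).trans (by simp [hg₁'])))
    (Prod.ext ((hpow g₂ ⟨p, hp⟩).trans (by simp [hg₂']))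
      ((hpow g₂ ⟨q, hq⟩).trans (by simp [hg₂])))
  rw [finrank_map_eq_of_ker_eq _ μ ((biProj r s).evalOn C) fun F hF => ?_] at key
  · change (biProj r s).hilbertFunction C (t • segreDeg r s) + 2 ≤
      (biProj r s).hilbertFunction C ((t + 1) • segreDeg r s) at key
    push_cast at ht'
    omega
  · refine ⟨fun h => funext fun x => ?_, fun h => funext fun x => ?_⟩
    · refine CoordSpace.eval_eq_zero_of_mul hirr (isWeightedHomogeneous_segreForm f) hF hz
        (by rwa [eval_coord_segreForm]) (fun w hw => ?_) x.1 x.2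
      rw [eval_coord_segreForm, ← hμ F ⟨w, hw⟩, h]; rfl
    · rw [hμ F x]
      exact mul_eq_zero_of_right _ (congrFun h x)

/-- If one linear combination of two pure tensors with nonzero coefficients is pure, then all linear
combinations are. -/
theorem exists_segreVec_eq_of_smul_add_smul {a a' v : Fin (r + 1) → ℂ} {c c' w : Fin (s + 1) → ℂ}
    {α β : ℂ} (ha : a ≠ 0) (hc : c ≠ 0) (hα : α ≠ 0) (hβ : β ≠ 0)
    (h : α • segreVec a c + β • segreVec a' c' = segreVec v w) (x y : ℂ) :
    ∃ v w, x • segreVec a c + y • segreVec a' c' = segreVec v w := by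
  rw [← segreVec_smul_left α, ← segreVec_smul_right β] at h
  rcases exists_smul_of_segreVec_add_eq (smul_ne_zero hα ha) hc h with ⟨k, rfl⟩ | ⟨k, hk⟩
  · refine ⟨a, x • c + (y * (k * α)) • c', ?_⟩
    rw [segreVec_add_right, segreVec_smul_right, segreVec_smul_right, smul_smul,
      segreVec_smul_left, smul_smul]
  · have hk' : c' = (k / β) • c := by
      rw [div_eq_inv_mul, ← smul_smul, ← hk, smul_smul, inv_mul_cancel₀ hβ, one_smul]
    refine ⟨x • a + (y * (k / β)) • a', c, ?_⟩
    rw [hk', segreVec_add_left, segreVec_smul_left, segreVec_smul_left, segreVec_smul_right,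
      smul_smul]

/-- A projective line that contains three points of the Segre variety lies on it. -/
theorem isSegreLine_span_pair {p q z : (biProj r s).Pt} (hpq : p ≠ q) (hzp : z ≠ p) (hzq : z ≠ q)
    (hz : segrePt z ∈ Submodule.span ℂ {segrePt p, segrePt q}) :
    IsSegreLine (Submodule.span ℂ {segrePt p, segrePt q}) := by
  refine ⟨finrank_span_pair_of_linearIndependent (linearIndependent_segrePt hpq), fun u hu => ?_⟩
  obtain ⟨α, β, hαβ⟩ := Submodule.mem_span_pair.mp hz
  obtain ⟨x, y, rfl⟩ := Submodule.mem_span_pair.mp hu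
  have hα : α ≠ 0 := by
    rintro rfl
    exact hzq (eq_of_segrePt_eq_smul (k := β) (by rw [← hαβ, zero_smul, zero_add]))
  have hβ : β ≠ 0 := by
    rintro rfl
    exact hzp (eq_of_segrePt_eq_smul (k := α) (by rw [← hαβ, zero_smul, add_zero]))
  exact exists_segreVec_eq_of_smul_add_smul (coord_ne_zero p.1) (coord_ne_zero p.2) hα hβ hαβ x y

theorem segreSpan_eq_span_pair {C : Set (biProj r s).Pt} (hC : IsLineInBiProj r s C)
    {p q : (biProj r s).Pt} (hp : p ∈ C) (hq : q ∈ C) (hpq : p ≠ q) :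
    segreSpan C = Submodule.span ℂ {segrePt p, segrePt q} := by
  -- a `(1, 1)`-form vanishing at `p` and `q` vanishes on `C`
  refine le_antisymm (Submodule.span_le.mpr ?_) (Submodule.span_mono ?_)
  · rintro _ ⟨z, hz, rfl⟩
    by_contra hzn
    obtain ⟨f, hf, hle⟩ := Submodule.exists_le_ker_of_notMem hzn
    exact hf (eq_zero_of_apply_segrePt_eq_zero hC.1.2.1 hC.2 hp hq hpq
      (hle (Submodule.subset_span (by simp))) (hle (Submodule.subset_span (by simp))) z hz)
  · rintro _ (rfl | rfl)
    exacts [⟨p, hp, rfl⟩, ⟨q, hq, rfl⟩]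

theorem subset_segrePreimage_segreSpan (C : Set (biProj r s).Pt) :
    C ⊆ segrePreimage (segreSpan C) := fun p hp => Submodule.subset_span ⟨p, hp, rfl⟩

theorem IsLineInBiProj.isSegreLine_segreSpan {C : Set (biProj r s).Pt}
    (hC : IsLineInBiProj r s C) : IsSegreLine (segreSpan C) := by
  have hinf : C.Infinite := infinite_of_hasDegree_one hC.2
  obtain ⟨p, hp⟩ := hinf.nonempty
  obtain ⟨q, hq, hqp⟩ := hinf.exists_notMem_finite (Set.finite_singleton p)
  obtain ⟨z, hz, hzpq⟩ := hinf.exists_notMem_finite (Set.toFinite {p, q})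
  simp only [Set.mem_insert_iff, Set.mem_singleton_iff, not_or] at hqp hzpq
  have hspan := segreSpan_eq_span_pair hC hp hq (Ne.symm hqp)
  rw [hspan]
  refine isSegreLine_span_pair (Ne.symm hqp) hzpq.1 hzpq.2 ?_
  rw [← hspan]
  exact subset_segrePreimage_segreSpan C hz

theorem IsLineInBiProj.segrePreimage_segreSpan {C : Set (biProj r s).Pt}
    (hC : IsLineInBiProj r s C) : segrePreimage (segreSpan C) = C :=
  (hC.isSegreLine_segreSpan.eq_of_isClosed_of_infinite hC.1.1
    (subset_segrePreimage_segreSpan C) (infinite_of_hasDegree_one hC.2)).symm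

theorem bijOn_segreSpan : Set.BijOn (segreSpan (r := r) (s := s)) {C | IsLineInBiProj r s C}
    {W | IsSegreLine W} := by
  refine ⟨fun C hC => hC.isSegreLine_segreSpan, fun C hC C' hC' h => ?_, fun W hW => ?_⟩
  · rw [← IsLineInBiProj.segrePreimage_segreSpan hC, h,
      IsLineInBiProj.segrePreimage_segreSpan hC']
  · exact ⟨segrePreimage W, hW.isLineInBiProj, hW.segreSpan_segrePreimage⟩

/-! ### The two families of lines -/

/-- The linear map `v ↦ v ⊗ w`. -/
def segreLeft (w : Fin (s + 1) → ℂ) :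
    (Fin (r + 1) → ℂ) →ₗ[ℂ] (Fin (r + 1) × Fin (s + 1) → ℂ) where
  toFun v := segreVec v w
  map_add' v v' := segreVec_add_left v v' w
  map_smul' k v := segreVec_smul_left k v w

/-- The linear map `w ↦ v ⊗ w`. -/
def segreRight (v : Fin (r + 1) → ℂ) :
    (Fin (s + 1) → ℂ) →ₗ[ℂ] (Fin (r + 1) × Fin (s + 1) → ℂ) where
  toFun w := segreVec v w
  map_add' w w' := segreVec_add_right v w w'
  map_smul' k w := segreVec_smul_right k v w

theorem segreLeft_injective {w : Fin (s + 1) → ℂ} (hw : w ≠ 0) :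
    Function.Injective (segreLeft (r := r) w) :=
  (injective_iff_map_eq_zero _).mpr fun _ h => (segreVec_eq_zero_iff.mp h).resolve_right hw

theorem segreRight_injective {v : Fin (r + 1) → ℂ} (hv : v ≠ 0) :
    Function.Injective (segreRight (s := s) v) :=
  (injective_iff_map_eq_zero _).mpr fun _ h => (segreVec_eq_zero_iff.mp h).resolve_left hv

theorem isSegreLine_map_segreLeft {L : Submodule ℂ (Fin (r + 1) → ℂ)}
    (hL : Module.finrank ℂ L = 2) {w : Fin (s + 1) → ℂ} (hw : w ≠ 0) :
    IsSegreLine (L.map (segreLeft w)) := by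
  refine ⟨?_, ?_⟩
  · rw [(Submodule.equivMapOfInjective _ (segreLeft_injective hw) L).symm.finrank_eq, hL]
  · rintro _ ⟨v, -, rfl⟩
    exact ⟨v, w, rfl⟩

theorem isSegreLine_map_segreRight {v : Fin (r + 1) → ℂ} (hv : v ≠ 0)
    {M : Submodule ℂ (Fin (s + 1) → ℂ)} (hM : Module.finrank ℂ M = 2) :
    IsSegreLine (M.map (segreRight v)) := by
  refine ⟨?_, ?_⟩
  · rw [(Submodule.equivMapOfInjective _ (segreRight_injective hv) M).symm.finrank_eq, hM]
  · rintro _ ⟨w, -, rfl⟩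
    exact ⟨v, w, rfl⟩

theorem IsSegreParam.eq_map {W : Submodule ℂ (Fin (r + 1) × Fin (s + 1) → ℂ)}
    {a a' : Fin (r + 1) → ℂ} {c c' : Fin (s + 1) → ℂ} (h : IsSegreParam W a a' c c') :
    W = (Submodule.span ℂ {a, a'}).map (segreLeft c) ∨
    W = (Submodule.span ℂ {c, c'}).map (segreRight a) := by
  have hspan := h.span_eq
  rcases h.eq_zero_or_eq_zero with rfl | rfl
  · rw [segreVec_zero_left, zero_add] at hspan
    rw [Submodule.map_span, Submodule.map_span, Set.image_pair, Set.image_pair]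
    exact .inr hspan.symm
  · rw [segreVec_zero_right, add_zero] at hspan
    rw [Submodule.map_span, Submodule.map_span, Set.image_pair, Set.image_pair]
    exact .inl hspan.symm

theorem IsSegreLine.exists_eq_map {W : Submodule ℂ (Fin (r + 1) × Fin (s + 1) → ℂ)}
    (hW : IsSegreLine W) :
    (∃ (L : (grLines r).Pt) (y : (projSpace s).Pt),
      W = L.1.map (segreLeft ((projSpace s).coord y))) ∨
    (∃ (x : (projSpace r).Pt) (M : (grLines s).Pt),
      W = M.1.map (segreRight ((projSpace r).coord x))) := by
  obtain ⟨p, hp⟩ := hW.nonempty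
  obtain ⟨a', c', h⟩ := hW.exists_param_of_mem hp
  rcases h.eq_map with e | e
  · refine .inl ⟨⟨_, ?_⟩, p.2, e⟩
    rw [← hW.1, e]
    exact (Submodule.equivMapOfInjective _ (segreLeft_injective (coord_ne_zero p.2)) _).finrank_eq
  · refine .inr ⟨p.1, ⟨_, ?_⟩, e⟩
    rw [← hW.1, e]
    exact (Submodule.equivMapOfInjective _ (segreRight_injective (coord_ne_zero p.1)) _).finrank_eq

theorem Projectivization.submodule_le_iff {V : Type*} [AddCommGroup V] [Module ℂ V]
    (x : Projectivization ℂ V) (L : Submodule ℂ V) : x.submodule ≤ L ↔ x.rep ∈ L := by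
  rw [Projectivization.submodule_eq, Submodule.span_singleton_le_iff_mem]

theorem mem_linePoints {L : (grLines r).Pt} {x : (projSpace r).Pt} :
    x ∈ linePoints L ↔ (projSpace r).coord x ∈ L.1 :=
  Projectivization.submodule_le_iff x L.1

theorem segrePreimage_map_segreLeft (L : (grLines r).Pt) (y : (projSpace s).Pt) :
    segrePreimage (L.1.map (segreLeft ((projSpace s).coord y))) =
      biProjRect (linePoints L) {y} := by
  ext p
  refine ⟨fun ⟨v, hv, hp⟩ => ?_, fun ⟨h1, h2⟩ => ?_⟩
  · obtain ⟨c, d, h1, h2⟩ := exists_units_smul_of_segreVec_eq (k := 1) (coord_ne_zero p.1)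
      (coord_ne_zero p.2) (hp.symm.trans (one_smul _ _).symm)
    exact ⟨mem_linePoints.mpr (h1 ▸ L.1.smul_mem _ hv), pt_eq_of_coord_eq_smul h2⟩
  · obtain rfl : p.2 = y := h2
    exact ⟨_, mem_linePoints.mp h1, rfl⟩

theorem segrePreimage_map_segreRight (x : (projSpace r).Pt) (M : (grLines s).Pt) :
    segrePreimage (M.1.map (segreRight ((projSpace r).coord x))) =
      biProjRect {x} (linePoints M) := by
  ext p
  refine ⟨fun ⟨v, hv, hp⟩ => ?_, fun ⟨h1, h2⟩ => ?_⟩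
  · obtain ⟨c, d, h1, h2⟩ := exists_units_smul_of_segreVec_eq (k := 1) (coord_ne_zero p.1)
      (coord_ne_zero p.2) (hp.symm.trans (one_smul _ _).symm)
    exact ⟨pt_eq_of_coord_eq_smul h1, mem_linePoints.mpr (h2 ▸ M.1.smul_mem _ hv)⟩
  · obtain rfl : p.1 = x := h1
    exact ⟨_, mem_linePoints.mp h2, rfl⟩

theorem isLineInBiProj_left (L : (grLines r).Pt) (y : (projSpace s).Pt) :
    IsLineInBiProj r s (biProjRect (linePoints L) {y}) :=
  segrePreimage_map_segreLeft L y ▸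
    (isSegreLine_map_segreLeft L.2 (coord_ne_zero y)).isLineInBiProj

theorem isLineInBiProj_right (x : (projSpace r).Pt) (M : (grLines s).Pt) :
    IsLineInBiProj r s (biProjRect {x} (linePoints M)) :=
  segrePreimage_map_segreRight x M ▸
    (isSegreLine_map_segreRight (coord_ne_zero x) M.2).isLineInBiProj

theorem segreSpan_left (L : (grLines r).Pt) (y : (projSpace s).Pt) :
    segreSpan (biProjRect (linePoints L) {y}) = L.1.map (segreLeft ((projSpace s).coord y)) :=
  segrePreimage_map_segreLeft L y ▸
    (isSegreLine_map_segreLeft L.2 (coord_ne_zero y)).segreSpan_segrePreimage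

theorem segreSpan_right (x : (projSpace r).Pt) (M : (grLines s).Pt) :
    segreSpan (biProjRect {x} (linePoints M)) = M.1.map (segreRight ((projSpace r).coord x)) :=
  segrePreimage_map_segreRight x M ▸
    (isSegreLine_map_segreRight (coord_ne_zero x) M.2).segreSpan_segrePreimage

theorem isLineInBiProj_iff {C : Set (biProj r s).Pt} : IsLineInBiProj r s C ↔
    (∃ (L : (grLines r).Pt) (y : (projSpace s).Pt), C = biProjRect (linePoints L) {y}) ∨
    (∃ (x : (projSpace r).Pt) (M : (grLines s).Pt), C = biProjRect {x} (linePoints M)) := by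
  refine ⟨fun hC => ?_, ?_⟩
  · rw [← hC.segrePreimage_segreSpan]
    rcases hC.isSegreLine_segreSpan.exists_eq_map with ⟨L, y, h⟩ | ⟨x, M, h⟩
    · exact .inl ⟨L, y, by rw [h, segrePreimage_map_segreLeft]⟩
    · exact .inr ⟨x, M, by rw [h, segrePreimage_map_segreRight]⟩
  · rintro (⟨L, y, rfl⟩ | ⟨x, M, rfl⟩)
    exacts [isLineInBiProj_left L y, isLineInBiProj_right x M]

theorem linePoints_injective : Function.Injective (linePoints (r := r)) := by
  have key : ∀ L L' : (grLines r).Pt, linePoints L = linePoints L' → L.1 ≤ L'.1 := by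
    intro L L' h v hv
    by_cases hv0 : v = 0
    · rw [hv0]; exact L'.1.zero_mem
    obtain ⟨x, c, hx⟩ := exists_pt hv0
    have hxL : x ∈ linePoints L := mem_linePoints.mpr (hx ▸ L.1.smul_mem _ hv)
    rw [h, mem_linePoints, hx] at hxL
    exact (L'.1.smul_mem_iff c.ne_zero).mp hxL
  exact fun L L' h => Subtype.ext ((key L L' h).antisymm (key L' L h.symm))

/-- The map sending `(L, y)` to `L × {y}` and `(x, M)` to `{x} × M`. -/
def unionToFano (r s : ℕ) :
    ((grLines r).prod (projSpace s)).Pt ⊕ ((projSpace r).prod (grLines s)).Pt →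
      (fanoLines r s).Pt
  | .inl p => ⟨biProjRect (linePoints p.1) {p.2}, isLineInBiProj_left p.1 p.2⟩
  | .inr p => ⟨biProjRect {p.1} (linePoints p.2), isLineInBiProj_right p.1 p.2⟩

theorem biProjRect_left_ne_right (L : (grLines r).Pt) (y : (projSpace s).Pt)
    (x : (projSpace r).Pt) (M : (grLines s).Pt) :
    biProjRect (linePoints L) {y} ≠ biProjRect {x} (linePoints M) := by
  intro h
  refine infinite_of_hasDegree_one (isLineInBiProj_left L y).2
    ((Set.finite_singleton ((x, y) : (projSpace r).Pt × (projSpace s).Pt)).subset fun p hp => ?_)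
  exact Prod.ext (h ▸ hp : p ∈ biProjRect {x} (linePoints M)).1 hp.2

theorem unionToFano_bijective : Function.Bijective (unionToFano r s) := by
  refine ⟨?_, fun ⟨C, hC⟩ => ?_⟩
  · rintro (⟨L, y⟩ | ⟨x, M⟩) (⟨L', y'⟩ | ⟨x', M'⟩) h
    · have h' : linePoints L ×ˢ {y} = linePoints L' ×ˢ {y'} := congrArg Subtype.val h
      rw [Set.prod_eq_prod_iff_of_nonempty
        (infinite_of_hasDegree_one (isLineInBiProj_left L y).2).nonempty] at h'
      rw [linePoints_injective h'.1, Set.singleton_injective h'.2]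
    · exact absurd (congrArg Subtype.val h) (biProjRect_left_ne_right _ _ _ _)
    · exact absurd (congrArg Subtype.val h).symm (biProjRect_left_ne_right _ _ _ _)
    · have h' : {x} ×ˢ linePoints M = {x'} ×ˢ linePoints M' := congrArg Subtype.val h
      rw [Set.prod_eq_prod_iff_of_nonempty
        (infinite_of_hasDegree_one (isLineInBiProj_right x M).2).nonempty] at h'
      rw [linePoints_injective h'.2, Set.singleton_injective h'.1]
  · rcases isLineInBiProj_iff.mp hC with ⟨L, y, h⟩ | ⟨x, M, h⟩
    · exact ⟨.inl (L, y), Subtype.ext h.symm⟩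
    · exact ⟨.inr (x, M), Subtype.ext h.symm⟩

/-! ### Plücker coordinates -/

/-- Plücker coordinates may be computed from any basis, up to a common factor. -/
theorem exists_pluckerVec_eq {κ : Type} [Finite κ] {W : Submodule ℂ (κ → ℂ)}
    (hW : Module.finrank ℂ W = 2) {u v : κ → ℂ} (hu : u ∈ W) (hv : v ∈ W)
    (h : LinearIndependent ℂ ![u, v]) :
    ∃ c : ℂˣ, ∀ i k, pluckerVec W (i, k) = c * (u i * v k - u k * v i) := by
  set b := Module.finBasisOfFinrankEq ℂ W hW
  have hli : LinearIndependent ℂ ![(b 0 : κ → ℂ), (b 1 : κ → ℂ)] := by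
    have e : ![(b 0 : κ → ℂ), (b 1 : κ → ℂ)] = W.subtype ∘ b := by
      ext i : 1
      fin_cases i <;> rfl
    rw [e]
    exact b.linearIndependent.map' W.subtype W.ker_subtype
  have hspan := span_pair_eq_of_finrank_eq_two hW h hu hv
  obtain ⟨α, β, h0⟩ := Submodule.mem_span_pair.mp (hspan.ge (b 0).2)
  obtain ⟨γ, δ, h1⟩ := Submodule.mem_span_pair.mp (hspan.ge (b 1).2)
  rw [← h0, ← h1, LinearIndependent.pair_add_smul_add_smul_iff] at hli
  -- the factor is the determinant of the change of basis
  refine ⟨.mk0 (α * δ - β * γ) (sub_ne_zero.mpr hli.2), fun i k => ?_⟩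
  rw [pluckerVec, dif_pos hW]
  change (b 0 : κ → ℂ) i * (b 1 : κ → ℂ) k - (b 0 : κ → ℂ) k * (b 1 : κ → ℂ) i = _
  rw [← h0, ← h1]
  simp only [Pi.add_apply, Pi.smul_apply, smul_eq_mul, Units.val_mk0]
  ring

theorem exists_basis_of_finrank_eq_two {κ : Type} {W : Submodule ℂ (κ → ℂ)}
    (hW : Module.finrank ℂ W = 2) : ∃ u ∈ W, ∃ v ∈ W, LinearIndependent ℂ ![u, v] := by
  have : Nontrivial W := Module.nontrivial_of_finrank_pos (R := ℂ) (by rw [hW]; omega)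
  obtain ⟨u, hu⟩ := exists_ne (0 : W)
  obtain ⟨v, hv, h⟩ := exists_linearIndependent_pair_of_finrank_eq_two hW u.2 (by simpa using hu)
  exact ⟨u, u.2, v, hv, h⟩

theorem pluckerVec_diag {κ : Type} [Finite κ] {W : Submodule ℂ (κ → ℂ)}
    (hW : Module.finrank ℂ W = 2) (i : κ) : pluckerVec W (i, i) = 0 := by
  obtain ⟨u, hu, v, hv, h⟩ := exists_basis_of_finrank_eq_two hW
  obtain ⟨c, hc⟩ := exists_pluckerVec_eq hW hu hv h
  rw [hc, sub_self, mul_zero]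

theorem exists_pluckerVec_ne_zero {κ : Type} [Finite κ] {W : Submodule ℂ (κ → ℂ)}
    (hW : Module.finrank ℂ W = 2) : ∃ i k, pluckerVec W (i, k) ≠ 0 := by
  obtain ⟨u, hu, v, hv, h⟩ := exists_basis_of_finrank_eq_two hW
  obtain ⟨c, hc⟩ := exists_pluckerVec_eq hW hu hv h
  by_contra! h0
  have hu0 : u ≠ 0 := h.ne_zero 0
  obtain ⟨k, hk⟩ := exists_smul_eq_of_minors (b := v) hu0 fun i k => sub_eq_zero.mp
    ((mul_eq_zero.mp ((hc i k).symm.trans (h0 i k))).resolve_left c.ne_zero)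
  exact (LinearIndependent.pair_iff' hu0).mp h k hk.symm

/-- The Plücker coordinates of `L × {y}` are the products `p i k * y j * y l`, where `p` are the
Plücker coordinates of `L`. -/
theorem exists_coord_unionToFano_inl (p : ((grLines r).prod (projSpace s)).Pt) :
    ∃ c : ℂˣ, ∀ i j k l, (fanoLines r s).coord (unionToFano r s (.inl p)) ((i, j), (k, l)) =
      c * ((grLines r).coord p.1 (i, k) * (projSpace s).coord p.2 j *
        (projSpace s).coord p.2 l) := by
  obtain ⟨L, y⟩ := p
  have hy : (projSpace s).coord y ≠ 0 := coord_ne_zero y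
  obtain ⟨u, hu, v, hv, h⟩ := exists_basis_of_finrank_eq_two L.2
  obtain ⟨c, hc⟩ := exists_pluckerVec_eq L.2 hu hv h
  obtain ⟨d, hd⟩ := exists_pluckerVec_eq (isSegreLine_map_segreLeft L.2 hy).1
    (Submodule.mem_map_of_mem hu) (Submodule.mem_map_of_mem hv) (by
      rw [LinearIndependent.pair_iff] at h ⊢
      intro a b hab
      refine h a b (segreLeft_injective hy ?_)
      rw [map_add, map_smul, map_smul, hab, map_zero])
  refine ⟨d * c⁻¹, fun i j k l => ?_⟩
  change pluckerVec (segreSpan (biProjRect (linePoints L) {y})) ((i, j), (k, l)) =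
    _ * (pluckerVec L.1 (i, k) * _ * _)
  rw [segreSpan_left, hd, hc]
  change (d : ℂ) * ((u i * (projSpace s).coord y j) * (v k * (projSpace s).coord y l) -
    (u k * (projSpace s).coord y l) * (v i * (projSpace s).coord y j)) = _
  have hc0 := c.ne_zero
  push_cast
  field_simp

/-- The Plücker coordinates of `{x} × M` are the products `x i * x k * q j l`, where `q` are the
Plücker coordinates of `M`. -/
theorem exists_coord_unionToFano_inr (p : ((projSpace r).prod (grLines s)).Pt) :
    ∃ c : ℂˣ, ∀ i j k l, (fanoLines r s).coord (unionToFano r s (.inr p)) ((i, j), (k, l)) =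
      c * ((projSpace r).coord p.1 i * (projSpace r).coord p.1 k *
        (grLines s).coord p.2 (j, l)) := by
  obtain ⟨x, M⟩ := p
  have hx : (projSpace r).coord x ≠ 0 := coord_ne_zero x
  obtain ⟨u, hu, v, hv, h⟩ := exists_basis_of_finrank_eq_two M.2
  obtain ⟨c, hc⟩ := exists_pluckerVec_eq M.2 hu hv h
  obtain ⟨d, hd⟩ := exists_pluckerVec_eq (isSegreLine_map_segreRight hx M.2).1
    (Submodule.mem_map_of_mem hu) (Submodule.mem_map_of_mem hv) (by
      rw [LinearIndependent.pair_iff] at h ⊢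
      intro a b hab
      refine h a b (segreRight_injective hx ?_)
      rw [map_add, map_smul, map_smul, hab, map_zero])
  refine ⟨d * c⁻¹, fun i j k l => ?_⟩
  change pluckerVec (segreSpan (biProjRect {x} (linePoints M))) ((i, j), (k, l)) =
    _ * (_ * _ * pluckerVec M.1 (j, l))
  rw [segreSpan_right, hd, hc]
  change (d : ℂ) * (((projSpace r).coord x i * u j) * ((projSpace r).coord x k * v l) -
    ((projSpace r).coord x k * u l) * ((projSpace r).coord x i * v j)) = _
  have hc0 := c.ne_zero
  push_cast
  field_simp

/-! ### The isomorphism -/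

theorem eval_X_mul_X_mul_X {σ : Type*} (g : σ → ℂ) (i j k : σ) :
    eval g (X i * X j * X k) = g i * g j * g k := by
  simp

/-- The Plücker coordinates of `L × {y}` are forms of bidegree `(1, 2)`. -/
theorem isPolyOn_unionToFano_inl :
    CoordSpace.IsPolyOn (X := (grLines r).prod (projSpace s)) (Z := fanoLines r s)
      (fun p => unionToFano r s (.inl p)) Set.univ := by
  refine ⟨multiplesHom (ℕ × ℕ) (1, 2),
    fun v => X (Sum.inl (v.1.1, v.2.1)) * X (Sum.inr v.1.2) * X (Sum.inr v.2.2), fun v => ?_,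
    fun p _ => ?_⟩
  · exact ((isWeightedHomogeneous_X ℂ ((grLines r).prod (projSpace s)).wt
      (Sum.inl (v.1.1, v.2.1))).mul (isWeightedHomogeneous_X ℂ _ (Sum.inr v.1.2))).mul
      (isWeightedHomogeneous_X ℂ _ (Sum.inr v.2.2))
  · obtain ⟨c, hc⟩ := exists_coord_unionToFano_inl p
    refine ⟨powersHom ℂˣ c, fun ⟨⟨i, j⟩, ⟨k, l⟩⟩ => (hc i j k l).trans ?_⟩
    change _ = ((c ^ 1 : ℂˣ) : ℂ) * _
    rw [pow_one]
    exact congrArg (HMul.hMul (c : ℂ)) (eval_X_mul_X_mul_X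
      (((grLines r).prod (projSpace s)).coord p) (Sum.inl (i, k)) (Sum.inr j) (Sum.inr l)).symm

/-- The Plücker coordinates of `{x} × M` are forms of bidegree `(2, 1)`. -/
theorem isPolyOn_unionToFano_inr :
    CoordSpace.IsPolyOn (X := (projSpace r).prod (grLines s)) (Z := fanoLines r s)
      (fun p => unionToFano r s (.inr p)) Set.univ := by
  refine ⟨multiplesHom (ℕ × ℕ) (2, 1),
    fun v => X (Sum.inl v.1.1) * X (Sum.inl v.2.1) * X (Sum.inr (v.1.2, v.2.2)), fun v => ?_,
    fun p _ => ?_⟩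
  · exact ((isWeightedHomogeneous_X ℂ ((projSpace r).prod (grLines s)).wt
      (Sum.inl v.1.1)).mul (isWeightedHomogeneous_X ℂ _ (Sum.inl v.2.1))).mul
      (isWeightedHomogeneous_X ℂ _ (Sum.inr (v.1.2, v.2.2)))
  · obtain ⟨c, hc⟩ := exists_coord_unionToFano_inr p
    refine ⟨powersHom ℂˣ c, fun ⟨⟨i, j⟩, ⟨k, l⟩⟩ => (hc i j k l).trans ?_⟩
    change _ = ((c ^ 1 : ℂˣ) : ℂ) * _
    rw [pow_one]
    exact congrArg (HMul.hMul (c : ℂ)) (eval_X_mul_X_mul_X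
      (((projSpace r).prod (grLines s)).coord p) (Sum.inl i) (Sum.inl k) (Sum.inr (j, l))).symm

theorem eq_inv_pow_mul_mul (c a b d : ℂˣ) (x : ℂ) :
    x = (((c * a * b)⁻¹ ^ 1 * d ^ 0 : ℂˣ) : ℂ) * (c * a * b * x) := by
  rw [pow_one, pow_zero, mul_one, ← Units.val_mul, ← Units.val_mul, Units.inv_mul_cancel_left]

theorem eq_mul_inv_pow_mul (c a b d : ℂˣ) (x : ℂ) :
    x = ((d ^ 0 * (c * a * b)⁻¹ ^ 1 : ℂˣ) : ℂ) * (c * a * b * x) := by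
  rw [mul_comm (d ^ 0)]
  exact eq_inv_pow_mul_mul c a b d x

/-- The locus in the Fano variety where a given Plücker coordinate does not vanish. -/
def fanoChart (v : (fanoLines r s).Var) : Set (fanoLines r s).Pt :=
  {z | (fanoLines r s).coord z v ≠ 0}

theorem isOpen_fanoChart (v : (fanoLines r s).Var) : IsOpen (fanoChart v) := by
  have := (fanoLines r s).isOpen_ne_zero (isWeightedHomogeneous_X ℂ (fanoLines r s).wt v)
  simp only [eval_X] at this
  exact this

/-- The Plücker coordinates with indices `(i, j)` and `(k, j)` vanish on the lines `{x} × M`; where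
one of them does not vanish, suitable Plücker coordinates of `L × {y}` are proportional to the
coordinates of `L` and of `y`. -/
theorem exists_local_inverse_inl (p : ((grLines r).prod (projSpace s)).Pt) :
    ∃ (V : Set (fanoLines r s).Pt) (ψ : (fanoLines r s).Pt → ((grLines r).prod (projSpace s)).Pt),
      IsOpen V ∧ unionToFano r s (.inl p) ∈ V ∧ CoordSpace.IsPolyOn ψ V ∧
      ∀ z ∈ V, unionToFano r s (.inl (ψ z)) = z := by
  obtain ⟨i₀, k₀, hik⟩ := exists_pluckerVec_ne_zero p.1.2
  obtain ⟨j₀, hj⟩ := Function.ne_iff.mp (coord_ne_zero p.2)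
  have hV : ∀ z ∈ fanoChart (r := r) (s := s) ((i₀, j₀), (k₀, j₀)),
      ∃ q, unionToFano r s (.inl q) = z := by
    intro z hz
    obtain ⟨q | q, rfl⟩ := unionToFano_bijective.2 z
    · exact ⟨q, rfl⟩
    · obtain ⟨c, hc⟩ := exists_coord_unionToFano_inr q
      refine absurd ((hc i₀ j₀ k₀ j₀).trans ?_) hz
      rw [show (grLines s).coord q.2 (j₀, j₀) = 0 from pluckerVec_diag q.2.2 j₀, mul_zero, mul_zero]
  have : Nonempty ((grLines r).prod (projSpace s)).Pt := ⟨p⟩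
  obtain ⟨ψ, hψ⟩ : ∃ ψ : (fanoLines r s).Pt → ((grLines r).prod (projSpace s)).Pt,
      ∀ z ∈ fanoChart (r := r) (s := s) ((i₀, j₀), (k₀, j₀)), unionToFano r s (.inl (ψ z)) = z :=
    ⟨Function.invFun fun q => unionToFano r s (.inl q), fun z hz => Function.invFun_eq (hV z hz)⟩
  refine ⟨fanoChart ((i₀, j₀), (k₀, j₀)), ψ, isOpen_fanoChart _, ?_, ?_, hψ⟩
  · obtain ⟨c, hc⟩ := exists_coord_unionToFano_inl p
    exact fun h => mul_ne_zero c.ne_zero (mul_ne_zero (mul_ne_zero hik hj) hj)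
      ((hc i₀ j₀ k₀ j₀).symm.trans h)
  · refine ⟨AddMonoidHom.coprod (.id ℕ) (.id ℕ), Sum.elim (fun w => X ((w.1, j₀), (w.2, j₀)))
      (fun l => X ((i₀, j₀), (k₀, l))), ?_, fun z hz => ?_⟩
    · rintro (w | l)
      · exact isWeightedHomogeneous_X ℂ (fanoLines r s).wt ((w.1, j₀), (w.2, j₀))
      · exact isWeightedHomogeneous_X ℂ (fanoLines r s).wt ((i₀, j₀), (k₀, l))
    · obtain ⟨c, hc⟩ := exists_coord_unionToFano_inl (ψ z)
      rw [hψ z hz] at hc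
      have h1 := mul_ne_zero_iff.mp (left_ne_zero_of_mul (right_ne_zero_of_mul
        fun h => hz ((hc i₀ j₀ k₀ j₀).trans h)))
      refine ⟨biChar (c * .mk0 _ h1.2 * .mk0 _ h1.2)⁻¹ (c * .mk0 _ h1.1 * .mk0 _ h1.2)⁻¹, ?_⟩
      rintro (⟨i, k⟩ | l)
      · exact (eq_inv_pow_mul_mul c (.mk0 _ h1.2) (.mk0 _ h1.2) _
          ((grLines r).coord (ψ z).1 (i, k))).trans
          (congrArg (HMul.hMul _) (((eval_X (f := (fanoLines r s).coord z)
            ((i, j₀), (k, j₀))).trans (hc i j₀ k j₀)).trans (by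
              simp only [Units.val_mk0]; ring)).symm)
      · exact (eq_mul_inv_pow_mul c (.mk0 _ h1.1) (.mk0 _ h1.2) _
          ((projSpace s).coord (ψ z).2 l)).trans
          (congrArg (HMul.hMul _) (((eval_X (f := (fanoLines r s).coord z)
            ((i₀, j₀), (k₀, l))).trans (hc i₀ j₀ k₀ l)).trans (by
              simp only [Units.val_mk0]; ring)).symm)

/-- The Plücker coordinates with indices `(i, j)` and `(i, l)` vanish on the lines `L × {y}`; where
one of them does not vanish, suitable Plücker coordinates of `{x} × M` are proportional to the
coordinates of `x` and of `M`. -/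
theorem exists_local_inverse_inr (p : ((projSpace r).prod (grLines s)).Pt) :
    ∃ (V : Set (fanoLines r s).Pt) (ψ : (fanoLines r s).Pt → ((projSpace r).prod (grLines s)).Pt),
      IsOpen V ∧ unionToFano r s (.inr p) ∈ V ∧ CoordSpace.IsPolyOn ψ V ∧
      ∀ z ∈ V, unionToFano r s (.inr (ψ z)) = z := by
  obtain ⟨j₀, l₀, hjl⟩ := exists_pluckerVec_ne_zero p.2.2
  obtain ⟨i₀, hi⟩ := Function.ne_iff.mp (coord_ne_zero p.1)
  have hV : ∀ z ∈ fanoChart (r := r) (s := s) ((i₀, j₀), (i₀, l₀)),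
      ∃ q, unionToFano r s (.inr q) = z := by
    intro z hz
    obtain ⟨q | q, rfl⟩ := unionToFano_bijective.2 z
    · obtain ⟨c, hc⟩ := exists_coord_unionToFano_inl q
      refine absurd ((hc i₀ j₀ i₀ l₀).trans ?_) hz
      rw [show (grLines r).coord q.1 (i₀, i₀) = 0 from pluckerVec_diag q.1.2 i₀, zero_mul,
        zero_mul, mul_zero]
    · exact ⟨q, rfl⟩
  have : Nonempty ((projSpace r).prod (grLines s)).Pt := ⟨p⟩
  obtain ⟨ψ, hψ⟩ : ∃ ψ : (fanoLines r s).Pt → ((projSpace r).prod (grLines s)).Pt,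
      ∀ z ∈ fanoChart (r := r) (s := s) ((i₀, j₀), (i₀, l₀)), unionToFano r s (.inr (ψ z)) = z :=
    ⟨Function.invFun fun q => unionToFano r s (.inr q), fun z hz => Function.invFun_eq (hV z hz)⟩
  refine ⟨fanoChart ((i₀, j₀), (i₀, l₀)), ψ, isOpen_fanoChart _, ?_, ?_, hψ⟩
  · obtain ⟨c, hc⟩ := exists_coord_unionToFano_inr p
    exact fun h => mul_ne_zero c.ne_zero (mul_ne_zero (mul_ne_zero hi hi) hjl)
      ((hc i₀ j₀ i₀ l₀).symm.trans h)
  · refine ⟨AddMonoidHom.coprod (.id ℕ) (.id ℕ), Sum.elim (fun k => X ((i₀, j₀), (k, l₀)))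
      (fun w => X ((i₀, w.1), (i₀, w.2))), ?_, fun z hz => ?_⟩
    · rintro (k | w)
      · exact isWeightedHomogeneous_X ℂ (fanoLines r s).wt ((i₀, j₀), (k, l₀))
      · exact isWeightedHomogeneous_X ℂ (fanoLines r s).wt ((i₀, w.1), (i₀, w.2))
    · obtain ⟨c, hc⟩ := exists_coord_unionToFano_inr (ψ z)
      rw [hψ z hz] at hc
      have h1 := mul_ne_zero_iff.mp (right_ne_zero_of_mul
        fun h => hz ((hc i₀ j₀ i₀ l₀).trans h))
      have h2 := left_ne_zero_of_mul h1.1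
      have h3 := h1.2
      refine ⟨biChar (c * .mk0 _ h2 * .mk0 _ h3)⁻¹ (c * .mk0 _ h2 * .mk0 _ h2)⁻¹, ?_⟩
      rintro (k | ⟨j, l⟩)
      · exact (eq_inv_pow_mul_mul c (.mk0 _ h2) (.mk0 _ h3) _
          ((projSpace r).coord (ψ z).1 k)).trans
          (congrArg (HMul.hMul _) (((eval_X (f := (fanoLines r s).coord z)
            ((i₀, j₀), (k, l₀))).trans (hc i₀ j₀ k l₀)).trans (by
              simp only [Units.val_mk0]; ring)).symm)
      · exact (eq_mul_inv_pow_mul c (.mk0 _ h2) (.mk0 _ h2) _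
          ((grLines s).coord (ψ z).2 (j, l))).trans
          (congrArg (HMul.hMul _) (((eval_X (f := (fanoLines r s).coord z)
            ((i₀, j), (i₀, l))).trans (hc i₀ j i₀ l)).trans (by
              simp only [Units.val_mk0]; ring)).symm)

theorem exists_iso_grUnion_fanoLines :
    ∃ Φ : (grUnion r s).Iso (fanoLines r s).toFunSpace, ∀ p, Φ.toEquiv p = unionToFano r s p :=
  CoordSpace.exists_iso_of_isPolyOn (Equiv.ofBijective _ unionToFano_bijective)
    isPolyOn_unionToFano_inl isPolyOn_unionToFano_inr exists_local_inverse_inl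
    exists_local_inverse_inr

end

theorem mainTheorem7 (n m : ℕ) :
    -- the lines are exactly the products of a line in one factor and a point in the other
    (∀ C : Set (biProj (n + 1) (m + 1)).Pt,
      IsLineInBiProj (n + 1) (m + 1) C ↔
        (∃ (L : (grLines (n + 1)).Pt) (y : (projSpace (m + 1)).Pt),
          C = biProjRect (linePoints L) {y}) ∨
        (∃ (x : (projSpace (n + 1)).Pt) (M : (grLines (m + 1)).Pt),
          C = biProjRect {x} (linePoints M))) ∧
    -- under the Segre embedding they are the projective lines contained in the Segre variety
    Set.BijOn (segreSpan (r := n + 1) (s := m + 1))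
      {C | IsLineInBiProj (n + 1) (m + 1) C}
      {W | Module.finrank ℂ W = 2 ∧ ∀ u ∈ W, ∃ v w, u = segreVec v w} ∧
    -- the Fano variety is the disjoint union, as a variety
    (∃ Φ : (grUnion (n + 1) (m + 1)).Iso (fanoLines (n + 1) (m + 1)).toFunSpace,
      (∀ (L : (grLines (n + 1)).Pt) (y : (projSpace (m + 1)).Pt),
        (Φ.toEquiv (Sum.inl (L, y))).1 = biProjRect (linePoints L) {y}) ∧
      (∀ (x : (projSpace (n + 1)).Pt) (M : (grLines (m + 1)).Pt),
        (Φ.toEquiv (Sum.inr (x, M))).1 = biProjRect {x} (linePoints M))) := by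
  refine ⟨fun _ => isLineInBiProj_iff, bijOn_segreSpan, ?_⟩
  obtain ⟨Φ, hΦ⟩ := exists_iso_grUnion_fanoLines (r := n + 1) (s := m + 1)
  exact ⟨Φ, fun L y => congrArg Subtype.val (hΦ (.inl (L, y))),
    fun x M => congrArg Subtype.val (hΦ (.inr (x, M)))⟩
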